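/- Let $G=(V,E)$ be a finite undirected graph (loops and parallel edges are allowed), let $h,k$ be positive integers and let $\ell(1),\dots,\ell(k)$ be positive integers. An $h$-regular packing of $k$ forests in $G$ is a family $F_1,\dots,F_k$ of pairwise edge-disjoint subgraphs of $G$ (not necessarily spanning, isolated vertices allowed), each of which is a forest (i.e. contains no cycle), such that every vertex of $G$ belongs to exactly $h$ of the forests. For a partition $\mathcal P$ of $V$ (into non-empty sets), let $e_E(\mathcal P)$ be the number of edges of $G$ that have exactly one end in some member of $\mathcal P$, that is, whose ends lie in two different members of $\mathcal P$. Then there exists an $h$-regular packing $F_1,\dots,F_k$ of $k$ forests in $G$ such that $F_i$ has exactly $\ell(i)$ connected components for every $i=1,\dots,k$ if and only if the following three conditions hold: \begin{enumerate} \item $|V|\ge \ell(i)$ for every $1\le i\le k$; \item $h|V|\ge \sum_{i=1}^k \ell(i)$; \item $\sum_{i=1}^k \min\{\ell(i),|\mathcal P|\}+e_E(\mathcal P)\ge h|\mathcal P|$ for every partition $\mathcal P$ of $V$. \end{enumerate} -/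

import Mathlib

/-! Undirected graphs are multigraphs (Mathlib's `Graph α β`, with vertex set `G.vertexSet`,
edge set `G.edgeSet`; loops and parallel edges are allowed). A subgraph of `G` is some `H ≤ G`. -/

namespace ForestPacking

variable {α β : Type*}

/-- A cycle of length `n + 1` in `G`: pairwise distinct vertices `v 0, …, v n` and pairwise
distinct edges `e 0, …, e n`, where `e i` joins `v i` and `v (i + 1)`, indices being cyclic.
For `n = 0` this is a loop, for `n = 1` a pair of parallel edges. -/
def IsCycle (G : Graph α β) (n : ℕ) (v : Fin (n + 1) → α) (e : Fin (n + 1) → β) : Prop :=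
  Function.Injective v ∧ Function.Injective e ∧ ∀ i, G.IsLink (e i) (v i) (v (i + 1))

/-- A forest is a graph that has no cycle. -/
def IsForest (G : Graph α β) : Prop :=
  ∀ (n : ℕ) (v : Fin (n + 1) → α) (e : Fin (n + 1) → β), ¬ IsCycle G n v e

/-- The vertices that can be reached from `x` along edges of `G`. -/
def reachableSet (G : Graph α β) (x : α) : Set α :=
  {y | Relation.ReflTransGen G.Adj x y}

/-- The vertex sets of the connected components of `G`. -/
def components (G : Graph α β) : Set (Set α) :=
  {C | ∃ x ∈ G.vertexSet, C = reachableSet G x}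

/-- The number of connected components of `G`. -/
noncomputable def numComponents (G : Graph α β) : ℕ :=
  (components G).ncard

/-- The edge `e` of `G` enters `X`: it has one end in `X` and the other one outside of `X`. -/
def Enters (G : Graph α β) (e : β) (X : Set α) : Prop :=
  ∃ x y, G.IsLink e x y ∧ x ∈ X ∧ y ∉ X

/-- The number of edges of `G` that enter some member of the partition `P` of the vertex set. -/
noncomputable def crossingNumber (G : Graph α β) (P : Finpartition G.vertexSet) : ℕ :=
  {e ∈ G.edgeSet | ∃ X ∈ P.parts, Enters G e X}.ncard

/-- `F 0, …, F (k - 1)` is an `h`-regular packing of forests in `G`: the `F i` are pairwise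
edge-disjoint subgraphs of `G`, each a forest (not necessarily spanning), and every vertex of `G`
belongs to exactly `h` of them. -/
structure IsRegularForestPacking (G : Graph α β) (h k : ℕ) (F : Fin k → Graph α β) : Prop where
  le : ∀ i, F i ≤ G
  isForest : ∀ i, IsForest (F i)
  edgeDisjoint : ∀ i j, i ≠ j → Disjoint (F i).edgeSet (F j).edgeSet
  regular : ∀ v ∈ G.vertexSet, {i : Fin k | v ∈ (F i).vertexSet}.ncard = h

end ForestPacking

/-! Necessity is a count of incidences between parts and forests. Every part meets at least `h`
forests, and a forest meets at most as many parts as it has components plus crossing edges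
(`ncard_image_le`). The other two conditions hold because a graph has at least as many vertices as
components.

For sufficiency, pick one root in each component of the forests to be built, and record the roots by
a set `C v` of colours (indices of forests) at each vertex `v`. Suppose that the edges are oriented
so that for every non-empty `X` the arcs entering `X` and the colours present in `X` number at least
`h` together. Then, as in Lovász's proof of Edmonds' branching theorem, some colour can be passed
along an unused arc as long as a vertex has fewer than `h` colours (`CoverCondition.exists_arc`).
The head of the arc becomes a leaf of that forest, so the numbers of components never change.

Such an orientation is one that covers the intersecting supermodular function `h - |C(X)|`. By
`exists_orientation`, a theorem of Frank's type proved by uncrossing, it exists if on every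
subpartition the total demand is at most the number of crossing edges.

It remains to find the roots. Add a vertex `z` that carries all colours and write `k = h + d`. The
partition condition then becomes `RootCondition`, in which `l i` counts the roots of colour `i`
still to be placed; once all `l i` are zero, it yields the hypothesis of the orientation theorem.
`RootCondition.place` lowers a positive `l i` by one, with or without placing a root: otherwise
critical partitions could be coarsened for ever. This gives at most `l i` roots of colour `i`;
`exists_colourCount_eq` raises the numbers to exactly `l i`, using the bounds by `|V|` and `h|V|`.
-/

namespace ForestPacking

/-! ### Uncrossing of subpartitions -/

section Uncrossing

variable {W : Type*}

/-- A family of pairwise disjoint non-empty sets. -/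
structure IsSubpartition (P : Finset (Finset W)) : Prop where
  eq_of_mem : ∀ X ∈ P, ∀ Y ∈ P, ∀ w, w ∈ X → w ∈ Y → X = Y
  nonempty : ∀ X ∈ P, X.Nonempty

theorem IsSubpartition.mono {P Q : Finset (Finset W)} (hP : IsSubpartition P) (h : Q ⊆ P) :
    IsSubpartition Q :=
  ⟨fun X hX Y hY => hP.eq_of_mem X (h hX) Y (h hY), fun X hX => hP.nonempty X (h hX)⟩

/-- Some member of `P` separates `a` and `b`. -/
def Crosses (P : Finset (Finset W)) (a b : W) : Prop :=
  ∃ X ∈ P, ¬ (a ∈ X ↔ b ∈ X)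

theorem crosses_comm (P : Finset (Finset W)) (a b : W) : Crosses P a b ↔ Crosses P b a := by
  unfold Crosses
  simp only [iff_comm (a := a ∈ _)]

variable [DecidableEq W]

/-- Supermodularity on pairs of intersecting sets. -/
def IntersectingSupermodular (p : Finset W → ℤ) : Prop :=
  ∀ X Y : Finset W, (X ∩ Y).Nonempty → p X + p Y ≤ p (X ∪ Y) + p (X ∩ Y)

/-- `M` and `m` arise from the subpartitions `P` and `Q` by replacing repeatedly two properly
intersecting sets by their union and their intersection; `M` consists of the maximal sets
obtained. -/
structure IsUncrossing (P Q M m : Finset (Finset W)) : Prop where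
  coarse : IsSubpartition M
  fine : IsSubpartition m
  mem_coarse : ∀ w, (∃ X ∈ M, w ∈ X) ↔ (∃ X ∈ P, w ∈ X) ∨ ∃ X ∈ Q, w ∈ X
  mem_fine : ∀ w, (∃ X ∈ m, w ∈ X) ↔ (∃ X ∈ P, w ∈ X) ∧ ∃ X ∈ Q, w ∈ X
  left_subset : ∀ X ∈ P, ∃ Z ∈ M, X ⊆ Z
  right_subset : ∀ Y ∈ Q, ∃ Z ∈ M, Y ⊆ Z
  inter_subset : ∀ X ∈ P, ∀ Y ∈ Q, (X ∩ Y).Nonempty → ∃ Z ∈ m, X ∩ Y ⊆ Z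
  sum_le : ∀ p : Finset W → ℤ, IntersectingSupermodular p →
    ∑ X ∈ P, p X + ∑ Y ∈ Q, p Y ≤ ∑ Z ∈ M, p Z + ∑ Z ∈ m, p Z

/-- Uncross `Y` with the members of `S` in turn. As these are disjoint, what has been absorbed
earlier does not change the intersection of the next member with `Y`. -/
theorem IntersectingSupermodular.add_sum_le {p : Finset W → ℤ} (hp : IntersectingSupermodular p)
    (Y : Finset W) (S : Finset (Finset W)) (hS : IsSubpartition S)
    (hY : ∀ X ∈ S, (X ∩ Y).Nonempty) :
    p Y + ∑ X ∈ S, p X ≤ p (Y ∪ S.biUnion id) + ∑ X ∈ S, p (X ∩ Y) := by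
  induction S using Finset.induction_on with
  | empty => simp
  | insert A S hA ih =>
    have ih := ih (hS.mono (Finset.subset_insert _ _))
      (fun X hX => hY X (Finset.mem_insert_of_mem hX))
    have hinter : A ∩ (Y ∪ S.biUnion id) = A ∩ Y := by
      ext w
      simp only [Finset.mem_inter, Finset.mem_union, Finset.mem_biUnion, id]
      refine ⟨fun ⟨h1, h2⟩ => ⟨h1, h2.resolve_right ?_⟩, fun h => ⟨h.1, .inl h.2⟩⟩
      rintro ⟨B, hB, hw⟩
      have := hS.eq_of_mem A (Finset.mem_insert_self _ _) B (Finset.mem_insert_of_mem hB) w h1 hw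
      exact hA (this ▸ hB)
    have h := hp A (Y ∪ S.biUnion id) (hinter ▸ hY A (Finset.mem_insert_self _ _))
    have hun : A ∪ (Y ∪ S.biUnion id) = Y ∪ (insert A S).biUnion id := by
      ext w; simp; tauto
    rw [hinter, hun] at h
    rw [Finset.sum_insert hA, Finset.sum_insert hA]
    linarith

/-- The members of `M` that meet `Y` merge with it, and their traces on `Y` join `m`. The traces are
disjoint from the old `m`, which lives inside the union of `Q`. -/
theorem IsUncrossing.insert {P Q M m : Finset (Finset W)} (h : IsUncrossing P Q M m)
    (Y : Finset W) (hYne : Y.Nonempty) (hY : ∀ X ∈ Q, ∀ w, w ∈ X → w ∉ Y) :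
    IsUncrossing P (insert Y Q)
      (insert (Y ∪ {X ∈ M | (X ∩ Y).Nonempty}.biUnion id) {X ∈ M | ¬ (X ∩ Y).Nonempty})
      (m ∪ {X ∈ M | (X ∩ Y).Nonempty}.image (· ∩ Y)) := by
  set S := {X ∈ M | (X ∩ Y).Nonempty} with hS
  have hSM : S ⊆ M := Finset.filter_subset _ _
  have hYQ : Y ∉ Q := fun hmem => by
    obtain ⟨w, hw⟩ := hYne
    exact hY Y hmem w hw hw
  have hm_Y : ∀ Z ∈ m, ∀ w, w ∈ Z → w ∉ Y := by
    intro Z hZ w hw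
    obtain ⟨X, hX, hwX⟩ := ((h.mem_fine w).1 ⟨Z, hZ, hw⟩).2
    exact hY X hX w hwX
  have hinj : Set.InjOn (· ∩ Y) (S : Set (Finset W)) := by
    intro A hA B hB hAB
    obtain ⟨w, hw⟩ := (Finset.mem_filter.1 hA).2
    have hw' : w ∈ B ∩ Y := by
      have : A ∩ Y = B ∩ Y := hAB
      exact this ▸ hw
    exact h.coarse.eq_of_mem A (hSM hA) B (hSM hB) w (Finset.mem_inter.1 hw).1
      (Finset.mem_inter.1 hw').1
  have hsubM : ∀ X ∈ M, ∃ Z ∈ Insert.insert (Y ∪ S.biUnion id) {X ∈ M | ¬ (X ∩ Y).Nonempty},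
      X ⊆ Z := by
    intro X hX
    by_cases hXY : (X ∩ Y).Nonempty
    · refine ⟨_, Finset.mem_insert_self _ _, fun w hw => Finset.mem_union_right _ ?_⟩
      exact Finset.mem_biUnion.2 ⟨X, Finset.mem_filter.2 ⟨hX, hXY⟩, hw⟩
    · exact ⟨X, Finset.mem_insert_of_mem (Finset.mem_filter.2 ⟨hX, hXY⟩), subset_rfl⟩
  have hbig : ∀ X ∈ M, ¬ (X ∩ Y).Nonempty → ∀ w, w ∈ X → w ∉ Y ∪ S.biUnion id := by
    intro X hX hXY w hw hw'
    rcases Finset.mem_union.1 hw' with h1 | h1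
    · exact hXY ⟨w, Finset.mem_inter.2 ⟨hw, h1⟩⟩
    · obtain ⟨B, hB, hwB⟩ := Finset.mem_biUnion.1 h1
      have := h.coarse.eq_of_mem X hX B (hSM hB) w hw hwB
      exact hXY (this ▸ (Finset.mem_filter.1 hB).2)
  refine ⟨⟨?_, ?_⟩, ⟨?_, ?_⟩, ?_, ?_, ?_, ?_, ?_, ?_⟩
  · intro A hA B hB w hwA hwB
    rcases Finset.mem_insert.1 hA with rfl | hA <;> rcases Finset.mem_insert.1 hB with rfl | hB
    · rfl
    · exact absurd hwA (hbig B (Finset.mem_filter.1 hB).1 (Finset.mem_filter.1 hB).2 w hwB)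
    · exact absurd hwB (hbig A (Finset.mem_filter.1 hA).1 (Finset.mem_filter.1 hA).2 w hwA)
    · exact h.coarse.eq_of_mem A (Finset.mem_filter.1 hA).1 B (Finset.mem_filter.1 hB).1 w hwA hwB
  · intro A hA
    rcases Finset.mem_insert.1 hA with rfl | hA
    · exact hYne.mono Finset.subset_union_left
    · exact h.coarse.nonempty A (Finset.mem_filter.1 hA).1
  · intro A hA B hB w hwA hwB
    rcases Finset.mem_union.1 hA with hA | hA <;> rcases Finset.mem_union.1 hB with hB | hB
    · exact h.fine.eq_of_mem A hA B hB w hwA hwB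
    · obtain ⟨X, -, rfl⟩ := Finset.mem_image.1 hB
      exact absurd (Finset.mem_inter.1 hwB).2 (hm_Y A hA w hwA)
    · obtain ⟨X, -, rfl⟩ := Finset.mem_image.1 hA
      exact absurd (Finset.mem_inter.1 hwA).2 (hm_Y B hB w hwB)
    · obtain ⟨X, hX, rfl⟩ := Finset.mem_image.1 hA
      obtain ⟨X', hX', rfl⟩ := Finset.mem_image.1 hB
      rw [h.coarse.eq_of_mem X (hSM hX) X' (hSM hX') w (Finset.mem_inter.1 hwA).1
        (Finset.mem_inter.1 hwB).1]
  · intro A hA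
    rcases Finset.mem_union.1 hA with hA | hA
    · exact h.fine.nonempty A hA
    · obtain ⟨X, hX, rfl⟩ := Finset.mem_image.1 hA
      exact (Finset.mem_filter.1 hX).2
  · intro w
    have h0 := h.mem_coarse w
    constructor
    · rintro ⟨Z, hZ, hw⟩
      rcases Finset.mem_insert.1 hZ with rfl | hZ
      · rcases Finset.mem_union.1 hw with h1 | h1
        · exact .inr ⟨Y, Finset.mem_insert_self _ _, h1⟩
        · obtain ⟨B, hB, hwB⟩ := Finset.mem_biUnion.1 h1
          rcases h0.1 ⟨B, hSM hB, hwB⟩ with h2 | ⟨X, hX, hwX⟩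
          · exact .inl h2
          · exact .inr ⟨X, Finset.mem_insert_of_mem hX, hwX⟩
      · rcases h0.1 ⟨Z, (Finset.mem_filter.1 hZ).1, hw⟩ with h2 | ⟨X, hX, hwX⟩
        · exact .inl h2
        · exact .inr ⟨X, Finset.mem_insert_of_mem hX, hwX⟩
    · intro h1
      by_cases hwY : w ∈ Y
      · exact ⟨_, Finset.mem_insert_self _ _, Finset.mem_union_left _ hwY⟩
      · have : ∃ X ∈ M, w ∈ X := by
          refine h0.2 (h1.imp_right ?_)
          rintro ⟨X, hX, hwX⟩
          rcases Finset.mem_insert.1 hX with rfl | hX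
          · exact absurd hwX hwY
          · exact ⟨X, hX, hwX⟩
        obtain ⟨X, hX, hwX⟩ := this
        obtain ⟨Z, hZ, hXZ⟩ := hsubM X hX
        exact ⟨Z, hZ, hXZ hwX⟩
  · intro w
    have h0 := h.mem_coarse w
    have h0' := h.mem_fine w
    constructor
    · rintro ⟨Z, hZ, hw⟩
      rcases Finset.mem_union.1 hZ with hZ | hZ
      · obtain ⟨h1, X, hX, hwX⟩ := h0'.1 ⟨Z, hZ, hw⟩
        exact ⟨h1, X, Finset.mem_insert_of_mem hX, hwX⟩
      · obtain ⟨X, hX, rfl⟩ := Finset.mem_image.1 hZ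
        obtain ⟨hwX, hwY⟩ := Finset.mem_inter.1 hw
        refine ⟨?_, Y, Finset.mem_insert_self _ _, hwY⟩
        refine (h0.1 ⟨X, hSM hX, hwX⟩).resolve_right ?_
        rintro ⟨B, hB, hwB⟩
        exact hY B hB w hwB hwY
    · rintro ⟨h1, B, hB, hwB⟩
      rcases Finset.mem_insert.1 hB with rfl | hB
      · obtain ⟨X, hX, hwX⟩ := h0.2 (.inl h1)
        have hw : w ∈ X ∩ B := Finset.mem_inter.2 ⟨hwX, hwB⟩
        exact ⟨X ∩ B, Finset.mem_union_right _ (Finset.mem_image_of_mem _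
          (Finset.mem_filter.2 ⟨hX, ⟨w, hw⟩⟩)), hw⟩
      · obtain ⟨Z, hZ, hw⟩ := h0'.2 ⟨h1, B, hB, hwB⟩
        exact ⟨Z, Finset.mem_union_left _ hZ, hw⟩
  · intro X hX
    obtain ⟨Z, hZ, hXZ⟩ := h.left_subset X hX
    obtain ⟨Z', hZ', hZZ⟩ := hsubM Z hZ
    exact ⟨Z', hZ', hXZ.trans hZZ⟩
  · intro B hB
    rcases Finset.mem_insert.1 hB with rfl | hB
    · exact ⟨_, Finset.mem_insert_self _ _, Finset.subset_union_left⟩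
    · obtain ⟨Z, hZ, hXZ⟩ := h.right_subset B hB
      obtain ⟨Z', hZ', hZZ⟩ := hsubM Z hZ
      exact ⟨Z', hZ', hXZ.trans hZZ⟩
  · intro X hX B hB hne
    rcases Finset.mem_insert.1 hB with rfl | hB
    · obtain ⟨Z, hZ, hXZ⟩ := h.left_subset X hX
      have hsub := Finset.inter_subset_inter_right (u := B) hXZ
      exact ⟨Z ∩ B, Finset.mem_union_right _ (Finset.mem_image_of_mem _
        (Finset.mem_filter.2 ⟨hZ, hne.mono hsub⟩)), hsub⟩
    · obtain ⟨Z, hZ, hsub⟩ := h.inter_subset X hX B hB hne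
      exact ⟨Z, Finset.mem_union_left _ hZ, hsub⟩
  · intro p hp
    have h1 := h.sum_le p hp
    have h2 := hp.add_sum_le Y S (h.coarse.mono hSM) (fun X hX => (Finset.mem_filter.1 hX).2)
    have h3 : ∑ X ∈ S, p X + ∑ X ∈ M with ¬ (X ∩ Y).Nonempty, p X = ∑ X ∈ M, p X :=
      Finset.sum_filter_add_sum_filter_not _ _ _
    have h4 : Y ∪ S.biUnion id ∉ {X ∈ M | ¬ (X ∩ Y).Nonempty} := by
      intro hmem
      refine (Finset.mem_filter.1 hmem).2 ?_
      rwa [Finset.inter_eq_right.2 Finset.subset_union_left]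
    have h5 : Disjoint m (S.image (· ∩ Y)) := by
      refine Finset.disjoint_left.2 fun Z hZ hZ' => ?_
      obtain ⟨X, hX, rfl⟩ := Finset.mem_image.1 hZ'
      obtain ⟨w, hw⟩ := (Finset.mem_filter.1 hX).2
      exact hm_Y _ hZ w hw (Finset.mem_inter.1 hw).2
    rw [Finset.sum_insert hYQ, Finset.sum_insert h4, Finset.sum_union h5, Finset.sum_image hinj]
    linarith

theorem exists_isUncrossing {P Q : Finset (Finset W)} (hP : IsSubpartition P)
    (hQ : IsSubpartition Q) : ∃ M m, IsUncrossing P Q M m := by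
  induction Q using Finset.induction_on with
  | empty =>
    exact ⟨P, ∅, ⟨hP, ⟨by simp, by simp⟩, by simp, by simp, fun X hX => ⟨X, hX, subset_rfl⟩,
      by simp, by simp, by simp⟩⟩
  | insert Y Q hY ih =>
    obtain ⟨M, m, h⟩ := ih (hQ.mono (Finset.subset_insert _ _))
    refine ⟨_, _, h.insert Y (hQ.nonempty Y (Finset.mem_insert_self _ _)) fun X hX w hw hwY => ?_⟩
    have := hQ.eq_of_mem X (Finset.mem_insert_of_mem hX) Y (Finset.mem_insert_self _ _) w hw hwY
    exact hY (this ▸ hX)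

instance (P : Finset (Finset W)) (a b : W) : Decidable (Crosses P a b) :=
  inferInstanceAs (Decidable (∃ X ∈ P, _))

theorem IsSubpartition.not_crosses_iff {P : Finset (Finset W)} (hP : IsSubpartition P) (a b : W) :
    ¬ Crosses P a b ↔
      (∃ X ∈ P, a ∈ X ∧ b ∈ X) ∨ (¬ (∃ X ∈ P, a ∈ X) ∧ ¬ (∃ X ∈ P, b ∈ X)) := by
  unfold Crosses
  push Not
  constructor
  · intro h
    by_cases ha : ∃ X ∈ P, a ∈ X
    · obtain ⟨X, hX, haX⟩ := ha
      exact .inl ⟨X, hX, haX, (h X hX).1 haX⟩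
    · refine .inr ⟨fun X hX haX => ha ⟨X, hX, haX⟩, fun X hX hbX => ha ⟨X, hX, (h X hX).2 hbX⟩⟩
  · rintro (⟨X, hX, haX, hbX⟩ | ⟨h1, h2⟩) Y hY
    · refine ⟨fun h => ?_, fun h => ?_⟩
      · rwa [← hP.eq_of_mem X hX Y hY a haX h]
      · rwa [← hP.eq_of_mem X hX Y hY b hbX h]
    · exact ⟨fun h => absurd h (h1 Y hY), fun h => absurd h (h2 Y hY)⟩

/-- If `P` does not separate `a` and `b`, either one member contains both, and then so does a member
of `M`, or both are uncovered, and then `m` covers neither. The same holds for `Q`, and if neither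
family separates the pair, neither `M` nor `m` does. -/
theorem IsUncrossing.crosses_le {P Q M m : Finset (Finset W)} (h : IsUncrossing P Q M m)
    (hP : IsSubpartition P) (hQ : IsSubpartition Q) (a b : W) :
    (if Crosses M a b then 1 else 0) + (if Crosses m a b then 1 else 0) ≤
      (if Crosses P a b then 1 else 0) + (if Crosses Q a b then 1 else 0 : ℕ) := by
  have hsame : ∀ R : Finset (Finset W), (∀ X ∈ R, ∃ Z ∈ M, X ⊆ Z) →
      (∃ X ∈ R, a ∈ X ∧ b ∈ X) → ¬ Crosses M a b := by
    rintro R hR ⟨X, hX, ha, hb⟩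
    obtain ⟨Z, hZ, hXZ⟩ := hR X hX
    exact (h.coarse.not_crosses_iff a b).2 (.inl ⟨Z, hZ, hXZ ha, hXZ hb⟩)
  have hmin : ∀ R : Finset (Finset W), (∀ w, (∃ Z ∈ m, w ∈ Z) → ∃ X ∈ R, w ∈ X) →
      ¬ (∃ X ∈ R, a ∈ X) ∧ ¬ (∃ X ∈ R, b ∈ X) → ¬ Crosses m a b := fun R hR hab =>
    (h.fine.not_crosses_iff a b).2 (.inr ⟨fun hm => hab.1 (hR a hm), fun hm => hab.2 (hR b hm)⟩)
  have hminP := hmin P fun w hw => ((h.mem_fine w).1 hw).1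
  have hminQ := hmin Q fun w hw => ((h.mem_fine w).1 hw).2
  have key : ¬ Crosses P a b → ¬ Crosses M a b ∨ ¬ Crosses m a b := fun hc =>
    ((hP.not_crosses_iff a b).1 hc).imp (hsame P h.left_subset) hminP
  have key' : ¬ Crosses Q a b → ¬ Crosses M a b ∨ ¬ Crosses m a b := fun hc =>
    ((hQ.not_crosses_iff a b).1 hc).imp (hsame Q h.right_subset) hminQ
  have key2 : ¬ Crosses P a b → ¬ Crosses Q a b → ¬ Crosses M a b ∧ ¬ Crosses m a b := by
    intro hc hc'
    rcases (hP.not_crosses_iff a b).1 hc with h1 | h1 <;>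
      rcases (hQ.not_crosses_iff a b).1 hc' with h1' | h1'
    · refine ⟨hsame P h.left_subset h1, (h.fine.not_crosses_iff a b).2 (.inl ?_)⟩
      obtain ⟨X, hX, ha, hb⟩ := h1
      obtain ⟨Y, hY, ha', hb'⟩ := h1'
      obtain ⟨Z, hZ, hsub⟩ := h.inter_subset X hX Y hY ⟨a, Finset.mem_inter.2 ⟨ha, ha'⟩⟩
      exact ⟨Z, hZ, hsub (Finset.mem_inter.2 ⟨ha, ha'⟩), hsub (Finset.mem_inter.2 ⟨hb, hb'⟩)⟩
    · exact ⟨hsame P h.left_subset h1, hminQ h1'⟩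
    · exact ⟨hsame Q h.right_subset h1', hminP h1⟩
    · refine ⟨(h.coarse.not_crosses_iff a b).2 (.inr ⟨?_, ?_⟩), hminP h1⟩
      · exact fun hm => ((h.mem_coarse a).1 hm).elim h1.1 h1'.1
      · exact fun hm => ((h.mem_coarse b).1 hm).elim h1.2 h1'.2
  clear hmin hminP hminQ hsame
  clear h hP hQ
  split_ifs <;> first | omega | (exfalso; grind)

variable {β : Type*}

/-- The number of edges in `E` that are separated by a member of `P`, where the edge `e` joins
`s e` and `t e`. -/
def crossCount (E : Finset β) (s t : β → W) (P : Finset (Finset W)) : ℕ :=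
  {e ∈ E | Crosses P (s e) (t e)}.card

theorem IsUncrossing.crossCount_le {P Q M m : Finset (Finset W)} (h : IsUncrossing P Q M m)
    (hP : IsSubpartition P) (hQ : IsSubpartition Q) (E : Finset β) (s t : β → W) :
    crossCount E s t M + crossCount E s t m ≤ crossCount E s t P + crossCount E s t Q := by
  simp only [crossCount, Finset.card_filter, ← Finset.sum_add_distrib]
  exact Finset.sum_le_sum fun e _ => h.crosses_le hP hQ _ _

end Uncrossing


/-! ### Orientations covering an intersecting supermodular function -/

section Orientation

variable {W β : Type*} [DecidableEq W]

theorem IntersectingSupermodular.sub_entering {p : Finset W → ℤ} (hp : IntersectingSupermodular p)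
    (u v : W) :
    IntersectingSupermodular fun X => p X - if u ∉ X ∧ v ∈ X then 1 else 0 := by
  intro X Y hXY
  have h := hp X Y hXY
  by_cases h1 : u ∈ X <;> by_cases h2 : u ∈ Y <;> by_cases h3 : v ∈ X <;> by_cases h4 : v ∈ Y <;>
    simp [h1, h2, h3, h4] <;> linarith

theorem crossCount_insert [DecidableEq β] {E : Finset β} {e : β} (he : e ∉ E) (s t : β → W)
    (P : Finset (Finset W)) :
    crossCount (insert e E) s t P =
      crossCount E s t P + if Crosses P (s e) (t e) then 1 else 0 := by
  simp only [crossCount, Finset.card_filter, Finset.sum_insert he]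
  ring

/-- The demand is met while the edge `uv` is present but not after it is used as an arc from `u` to
`v`. So `P` is tight and needs the edge, yet the arc enters no member: the edge only leaves one. -/
theorem tight_of_orientation_fails {P : Finset (Finset W)} (hP : IsSubpartition P)
    {p : Finset W → ℤ} {u v : W} {c : ℕ}
    (h : ∑ X ∈ P, p X ≤ c + if Crosses P u v then 1 else 0)
    (h' : (c : ℤ) < ∑ X ∈ P, (p X - if u ∉ X ∧ v ∈ X then 1 else 0)) :
    (¬ ∃ X ∈ P, v ∈ X) ∧ (∃ X ∈ P, u ∈ X) ∧ (c : ℤ) + 1 ≤ ∑ X ∈ P, p X := by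
  rw [Finset.sum_sub_distrib] at h'
  have hnn : (0 : ℤ) ≤ ∑ X ∈ P, if u ∉ X ∧ v ∈ X then 1 else 0 :=
    Finset.sum_nonneg fun X _ => by split_ifs <;> simp
  have hc : Crosses P u v := by
    by_contra hc
    rw [if_neg hc] at h
    linarith
  rw [if_pos hc] at h
  have hno : ∀ X ∈ P, v ∈ X → u ∈ X := by
    intro X hX hv
    by_contra hu
    have : (1 : ℤ) ≤ ∑ X ∈ P, if u ∉ X ∧ v ∈ X then 1 else 0 := by
      refine le_trans ?_ (Finset.single_le_sum (f := fun X => if u ∉ X ∧ v ∈ X then (1 : ℤ) else 0)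
        (fun X _ => by split_ifs <;> simp) hX)
      simp [hu, hv]
    linarith
  have hv : ¬ ∃ X ∈ P, v ∈ X := by
    rintro ⟨X, hX, hv⟩
    exact (hP.not_crosses_iff u v).2 (.inl ⟨X, hX, hno X hX hv, hv⟩) hc
  refine ⟨hv, ?_, by linarith⟩
  obtain ⟨X, hX, hne⟩ := hc
  refine ⟨X, hX, ?_⟩
  by_contra hu
  exact hne ⟨fun h => absurd h hu, fun h => absurd ⟨X, hX, h⟩ hv⟩

/-- A graph has an orientation covering the intersecting supermodular function `p` if for every
subpartition the number of crossing edges is at least the demand of its members. -/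
theorem exists_orientation (U : Finset W) (E : Finset β) (s t : β → W) (p : Finset W → ℤ)
    (hp : IntersectingSupermodular p)
    (h : ∀ P, IsSubpartition P → (∀ X ∈ P, X ⊆ U) → ∑ X ∈ P, p X ≤ crossCount E s t P) :
    ∃ a b : β → W, (∀ e, (a e = s e ∧ b e = t e) ∨ (a e = t e ∧ b e = s e)) ∧
      ∀ X ⊆ U, X.Nonempty → p X ≤ {e ∈ E | a e ∉ X ∧ b e ∈ X}.card := by
  classical
  induction E using Finset.induction_on generalizing p with
  | empty =>
    refine ⟨s, t, fun e => .inl ⟨rfl, rfl⟩, fun X hX hne => ?_⟩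
    have := h {X} ⟨by simp, by simpa using hne⟩ (by simpa using hX)
    simpa [crossCount] using this
  | insert e E he ih =>
    -- Orienting `e` from `u` to `v` lowers by one the demand of the sets that the arc enters; the
    -- induction hypothesis is applied to the lowered demand.
    have step : ∀ u v : W, (u = s e ∧ v = t e) ∨ (u = t e ∧ v = s e) →
        (∀ P, IsSubpartition P → (∀ X ∈ P, X ⊆ U) →
          ∑ X ∈ P, (p X - if u ∉ X ∧ v ∈ X then 1 else 0) ≤ crossCount E s t P) →
        ∃ a b : β → W, (∀ e, (a e = s e ∧ b e = t e) ∨ (a e = t e ∧ b e = s e)) ∧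
          ∀ X ⊆ U, X.Nonempty → p X ≤ {e ∈ insert e E | a e ∉ X ∧ b e ∈ X}.card := by
      intro u v huv hq
      obtain ⟨a, b, hab, hcov⟩ := ih _ (hp.sub_entering u v) hq
      refine ⟨Function.update a e u, Function.update b e v, fun f => ?_, fun X hX hne => ?_⟩
      · by_cases hf : f = e
        · subst hf; simpa using huv
        · simpa [hf] using hab f
      · have h1 := hcov X hX hne
        have h2 : {f ∈ E | Function.update a e u f ∉ X ∧ Function.update b e v f ∈ X} =
            {f ∈ E | a f ∉ X ∧ b f ∈ X} := by
          refine Finset.filter_congr fun f hf => ?_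
          have : f ≠ e := fun h => he (h ▸ hf)
          simp [this]
        rw [Finset.filter_insert, h2]
        simp only [Function.update_self]
        split_ifs at h1 ⊢ with hc
        · rw [Finset.card_insert_of_notMem (by simp [he])]
          push_cast
          linarith
        · linarith
    by_contra hcon
    have hf : ∀ u v : W, (u = s e ∧ v = t e) ∨ (u = t e ∧ v = s e) → ∃ P, IsSubpartition P ∧
        (∀ X ∈ P, X ⊆ U) ∧ (¬ ∃ X ∈ P, v ∈ X) ∧ (∃ X ∈ P, u ∈ X) ∧
        (crossCount E s t P : ℤ) + 1 ≤ ∑ X ∈ P, p X := by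
      intro u v huv
      have h1 := mt (step u v huv) hcon
      push Not at h1
      obtain ⟨P, hP, hPU, hlt⟩ := h1
      have h2 := h P hP hPU
      rw [crossCount_insert he] at h2
      have h3 : Crosses P (s e) (t e) ↔ Crosses P u v := by
        rcases huv with ⟨rfl, rfl⟩ | ⟨rfl, rfl⟩
        · rfl
        · exact crosses_comm _ _ _
      simp only [h3] at h2
      push_cast at h2
      exact ⟨P, hP, hPU, tight_of_orientation_fails hP h2 hlt⟩
    -- If both orientations of `e` fail, there are two tight families, `P` avoiding `t e` and `Q`
    -- avoiding `s e`, each of which needs `e`. After uncrossing, `m` covers neither end, so `e` is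
    -- counted at most once instead of twice.
    obtain ⟨P, hP, hPU, hvP, huP, hPt⟩ := hf (s e) (t e) (.inl ⟨rfl, rfl⟩)
    obtain ⟨Q, hQ, hQU, hvQ, huQ, hQt⟩ := hf (t e) (s e) (.inr ⟨rfl, rfl⟩)
    obtain ⟨M, m, hMm⟩ := exists_isUncrossing hP hQ
    have hMU : ∀ X ∈ M, X ⊆ U := by
      intro X hX w hw
      rcases (hMm.mem_coarse w).1 ⟨X, hX, hw⟩ with ⟨Y, hY, hwY⟩ | ⟨Y, hY, hwY⟩
      · exact hPU Y hY hwY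
      · exact hQU Y hY hwY
    have hmU : ∀ X ∈ m, X ⊆ U := by
      intro X hX w hw
      obtain ⟨⟨Y, hY, hwY⟩, -⟩ := (hMm.mem_fine w).1 ⟨X, hX, hw⟩
      exact hPU Y hY hwY
    have hM := h M hMm.coarse hMU
    have hm := h m hMm.fine hmU
    rw [crossCount_insert he] at hM hm
    have hcm : ¬ Crosses m (s e) (t e) := by
      refine (hMm.fine.not_crosses_iff _ _).2 (.inr ⟨fun hh => ?_, fun hh => ?_⟩)
      · exact hvQ ((hMm.mem_fine _).1 hh).2
      · exact hvP ((hMm.mem_fine _).1 hh).1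
    rw [if_neg hcm] at hm
    have h1 := hMm.sum_le p hp
    have h2 := hMm.crossCount_le hP hQ E s t
    have h3 : (if Crosses M (s e) (t e) then 1 else 0) ≤ 1 := by split_ifs <;> simp
    zify at h2 h3
    push_cast at hM hm
    linarith

end Orientation


/-! ### Placing the roots -/

section Roots

variable {W β ι : Type*} [DecidableEq W]

/-- A partition of the finite set `U`. -/
structure IsPartition (U : Finset W) (P : Finset (Finset W)) : Prop extends IsSubpartition P where
  covers : ∀ w, (∃ X ∈ P, w ∈ X) ↔ w ∈ U

/-- `Z` does not meet the set of the vertices that have the colour `i`. -/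
def IsFree (C : W → Finset ι) (i : ι) (Z : Finset W) : Prop :=
  ∀ v ∈ Z, i ∉ C v

instance [DecidableEq ι] (C : W → Finset ι) (i : ι) (Z : Finset W) : Decidable (IsFree C i Z) :=
  inferInstanceAs (Decidable (∀ v ∈ Z, _))

variable [DecidableEq ι]

/-- The number of members of `P` that do not contain a vertex of colour `i`. -/
def freeCount (C : W → Finset ι) (i : ι) (P : Finset (Finset W)) : ℕ :=
  {X ∈ P | IsFree C i X}.card

theorem intersectingSupermodular_isFree (C : W → Finset ι) (i : ι) :
    IntersectingSupermodular fun X => if IsFree C i X then 1 else 0 := by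
  intro X Y _
  have h1 : IsFree C i (X ∪ Y) ↔ IsFree C i X ∧ IsFree C i Y := by
    simp [IsFree, or_imp, forall_and]
  have h2 : IsFree C i X ∨ IsFree C i Y → IsFree C i (X ∩ Y) := by
    rintro (h | h) v hv
    · exact h v (Finset.mem_inter.1 hv).1
    · exact h v (Finset.mem_inter.1 hv).2
  by_cases hX : IsFree C i X <;> by_cases hY : IsFree C i Y
  · simp [h1, hX, hY, h2 (.inl hX)]
  · simp [h1, hX, hY, h2 (.inl hX)]
  · simp [h1, hX, hY, h2 (.inr hY)]
  · simp only [h1, hX, hY, false_and, if_false, zero_add]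
    split_ifs <;> simp

/-- A free member of `Q` contains a member of `P`, which is free too and cannot belong to `S`. The
set `S` is there to give both the weak and the strict inequality. -/
theorem freeCount_coarse_le_erase {U : Finset W} {P Q : Finset (Finset W)} (hP : IsPartition U P)
    (hQ : IsPartition U Q) (hPQ : ∀ X ∈ P, ∃ Z ∈ Q, X ⊆ Z) (C : W → Finset ι) (i : ι)
    (S : Finset (Finset W)) (hS : ∀ X ∈ S, ∃ Z ∈ Q, X ⊆ Z ∧ ¬ IsFree C i Z) :
    freeCount C i Q ≤ ({X ∈ P | IsFree C i X} \ S).card := by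
  have hsub : {Z ∈ Q | IsFree C i Z} ⊆
      ({X ∈ P | IsFree C i X} \ S).image
        (fun X => if h : ∃ Z ∈ Q, X ⊆ Z then h.choose else ∅) := by
    intro Z hZ
    obtain ⟨hZQ, hZf⟩ := Finset.mem_filter.1 hZ
    obtain ⟨w, hw⟩ := hQ.nonempty Z hZQ
    obtain ⟨X, hX, hwX⟩ := (hP.covers w).2 ((hQ.covers w).1 ⟨Z, hZQ, hw⟩)
    have huniq : ∀ Z' ∈ Q, X ⊆ Z' → Z' = Z := fun Z' hZ' hXZ' =>
      hQ.eq_of_mem Z' hZ' Z hZQ w (hXZ' hwX) hw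
    have hex := hPQ X hX
    have hXZ : X ⊆ Z := by
      obtain ⟨Z', hZ', hXZ'⟩ := hex
      exact huniq Z' hZ' hXZ' ▸ hXZ'
    refine Finset.mem_image.2 ⟨X, Finset.mem_sdiff.2 ⟨Finset.mem_filter.2 ⟨hX, fun v hv =>
      hZf v (hXZ hv)⟩, fun hXS => ?_⟩, ?_⟩
    · obtain ⟨Z', hZ', hXZ', hnf⟩ := hS X hXS
      exact hnf (huniq Z' hZ' hXZ' ▸ hZf)
    · rw [dif_pos hex]
      exact huniq _ hex.choose_spec.1 hex.choose_spec.2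
  exact (Finset.card_le_card hsub).trans Finset.card_image_le

theorem freeCount_coarse_le {U : Finset W} {P Q : Finset (Finset W)} (hP : IsPartition U P)
    (hQ : IsPartition U Q) (hPQ : ∀ X ∈ P, ∃ Z ∈ Q, X ⊆ Z) (C : W → Finset ι) (i : ι) :
    freeCount C i Q ≤ freeCount C i P := by
  simpa [freeCount] using freeCount_coarse_le_erase hP hQ hPQ C i ∅ (by simp)

theorem freeCount_coarse_lt {U : Finset W} {P Q : Finset (Finset W)} (hP : IsPartition U P)
    (hQ : IsPartition U Q) (hPQ : ∀ X ∈ P, ∃ Z ∈ Q, X ⊆ Z) {C : W → Finset ι} {i : ι}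
    {X Z : Finset W} (hX : X ∈ P) (hXf : IsFree C i X) (hZ : Z ∈ Q) (hXZ : X ⊆ Z)
    (hZf : ¬ IsFree C i Z) :
    freeCount C i Q < freeCount C i P := by
  refine (freeCount_coarse_le_erase hP hQ hPQ C i {X} ?_).trans_lt (Finset.card_lt_card ?_)
  · intro Y hY
    rw [Finset.mem_singleton.1 hY]
    exact ⟨Z, hZ, hXZ, hZf⟩
  · refine Finset.ssubset_iff_subset_ne.2 ⟨Finset.sdiff_subset, fun h => ?_⟩
    have : X ∈ {X ∈ P | IsFree C i X} := Finset.mem_filter.2 ⟨hX, hXf⟩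
    rw [← h] at this
    simp at this

variable [Fintype ι]

/-- The condition under which `l i` new roots of colour `i` can be placed, for all `i`. -/
def RootCondition (U : Finset W) (E : Finset β) (s t : β → W) (d : ℕ) (C : W → Finset ι)
    (l : ι → ℕ) : Prop :=
  ∀ P, IsPartition U P → d + ∑ i, (freeCount C i P - l i) ≤ crossCount E s t P + d * P.card

variable {U : Finset W} {E : Finset β} {s t : β → W} {d : ℕ} {C : W → Finset ι} {l : ι → ℕ}

/-- The partition `P` satisfies the root condition with equality, and decreasing `l i` would
violate it. -/
structure IsCritical (U : Finset W) (E : Finset β) (s t : β → W) (d : ℕ) (C : W → Finset ι)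
    (l : ι → ℕ) (i : ι) (P : Finset (Finset W)) : Prop extends IsPartition U P where
  tight : crossCount E s t P + d * P.card ≤ d + ∑ i, (freeCount C i P - l i)
  le_freeCount : l i ≤ freeCount C i P

/-- Uncrossing preserves the number of members, does not increase the crossing edges and does not
decrease the free counts in total. Hence the two resulting partitions are tight as well, and `M` is
the common coarsening sought. -/
theorem IsCritical.exists_join (hC : RootCondition U E s t d C l) {i : ι}
    {P Q : Finset (Finset W)} (hP : IsCritical U E s t d C l i P)
    (hQ : IsCritical U E s t d C l i Q) :
    ∃ M, IsCritical U E s t d C l i M ∧ (∀ X ∈ P, ∃ Z ∈ M, X ⊆ Z) ∧ ∀ X ∈ Q, ∃ Z ∈ M, X ⊆ Z := by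
  obtain ⟨M, m, h⟩ := exists_isUncrossing hP.toIsSubpartition hQ.toIsSubpartition
  have hM : IsPartition U M := ⟨h.coarse, fun w => by
    rw [h.mem_coarse, hP.covers, hQ.covers, or_self]⟩
  have hm : IsPartition U m := ⟨h.fine, fun w => by
    rw [h.mem_fine, hP.covers, hQ.covers, and_self]⟩
  have hcross := h.crossCount_le hP.toIsSubpartition hQ.toIsSubpartition E s t
  have hcard : M.card + m.card = P.card + Q.card := by
    -- Both constants `1` and `-1` are supermodular, so the number of members is preserved.
    have h1 := h.sum_le (fun _ => 1) (fun _ _ _ => le_rfl)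
    have h2 := h.sum_le (fun _ => -1) (fun _ _ _ => le_rfl)
    simp at h1 h2
    omega
  have hfree : ∀ j, freeCount C j P + freeCount C j Q ≤ freeCount C j M + freeCount C j m := by
    intro j
    have h1 := h.sum_le _ (intersectingSupermodular_isFree C j)
    simp only [Finset.sum_boole] at h1
    exact_mod_cast h1
  have hle1 := fun j => freeCount_coarse_le hP.toIsPartition hM h.left_subset C j
  have hle2 := fun j => freeCount_coarse_le hQ.toIsPartition hM h.right_subset C j
  -- The truncated difference is monotone and convex, and `M`, being coarser, has the smaller free
  -- count: the values for `M` and `m` are at least as spread out. If the one for `M` lies below `l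
  -- i`, the inequality is strict for `i`, contrary to tightness.
  have hterm : ∀ j, (freeCount C j P - l j) + (freeCount C j Q - l j) ≤
      (freeCount C j M - l j) + (freeCount C j m - l j) := by
    intro j
    have := hfree j; have := hle1 j; have := hle2 j
    omega
  have hsum := Finset.sum_le_sum fun j (_ : j ∈ Finset.univ) => hterm j
  have hM' := hC M hM
  have hm' := hC m hm
  have hP' := hP.tight
  have hQ' := hQ.tight
  have hmul : d * M.card + d * m.card = d * P.card + d * Q.card := by
    rw [← mul_add, hcard, mul_add]
  simp only [Finset.sum_add_distrib] at hsum
  refine ⟨M, ⟨hM, by omega, ?_⟩, h.left_subset, h.right_subset⟩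
  by_contra hlt
  have hstrict : ∑ j, ((freeCount C j P - l j) + (freeCount C j Q - l j)) <
      ∑ j, ((freeCount C j M - l j) + (freeCount C j m - l j)) := by
    refine Finset.sum_lt_sum (fun j _ => hterm j) ⟨i, Finset.mem_univ _, ?_⟩
    have := hfree i; have := hP.le_freeCount; have := hQ.le_freeCount
    omega
  simp only [Finset.sum_add_distrib] at hstrict
  omega

/-- A vertex with `h` of the `h + d` colours leaves at most `d` colours free in `X`. Merging `X`
with the member containing `z` thus costs at most `d` in the sum and gains `d` from the number of
members. -/
theorem IsCritical.exists_merge (hC : RootCondition U E s t d C l) {i : ι} {h : ℕ}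
    (hd : Fintype.card ι = h + d) {z : W} (hz : z ∈ U) (hCz : C z = Finset.univ)
    {P : Finset (Finset W)} (hP : IsCritical U E s t d C l i P) {X : Finset W} (hX : X ∈ P)
    (hXf : IsFree C i X) {v : W} (hv : v ∈ X) (hfull : h ≤ (C v).card) :
    ∃ M, IsCritical U E s t d C l i M ∧ freeCount C i M < freeCount C i P := by
  obtain ⟨Z, hZ, hzZ⟩ := (hP.covers z).2 hz
  have hZf : ∀ j, ¬ IsFree C j Z := fun j hj => hj z hzZ (by simp [hCz])
  have hXZ : X ≠ Z := fun hh => hZf i (hh ▸ hXf)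
  set R := (P.erase X).erase Z with hR
  have hRP : R ⊆ P := (Finset.erase_subset _ _).trans (Finset.erase_subset _ _)
  have hRX : ∀ Y ∈ R, Y ≠ X ∧ Y ≠ Z := fun Y hY =>
    ⟨(Finset.mem_erase.1 (Finset.mem_erase.1 hY).2).1, (Finset.mem_erase.1 hY).1⟩
  have hdisj : ∀ Y ∈ R, ∀ w, w ∈ Y → w ∉ X ∪ Z := by
    intro Y hY w hw hw'
    rcases Finset.mem_union.1 hw' with h1 | h1
    · exact (hRX Y hY).1 (hP.eq_of_mem Y (hRP hY) X hX w hw h1)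
    · exact (hRX Y hY).2 (hP.eq_of_mem Y (hRP hY) Z hZ w hw h1)
  have hcoarse : ∀ Y ∈ P, ∃ Y' ∈ insert (X ∪ Z) R, Y ⊆ Y' := by
    intro Y hY
    by_cases h1 : Y = X
    · exact ⟨_, Finset.mem_insert_self _ _, h1 ▸ Finset.subset_union_left⟩
    by_cases h2 : Y = Z
    · exact ⟨_, Finset.mem_insert_self _ _, h2 ▸ Finset.subset_union_right⟩
    · exact ⟨Y, Finset.mem_insert_of_mem (by simp [hR, h1, h2, hY]), subset_rfl⟩
  have hM : IsPartition U (insert (X ∪ Z) R) := by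
    refine ⟨⟨?_, ?_⟩, fun w => ?_⟩
    · intro A hA B hB w hwA hwB
      rcases Finset.mem_insert.1 hA with rfl | hA <;> rcases Finset.mem_insert.1 hB with rfl | hB
      · rfl
      · exact absurd hwA (hdisj B hB w hwB)
      · exact absurd hwB (hdisj A hA w hwA)
      · exact hP.eq_of_mem A (hRP hA) B (hRP hB) w hwA hwB
    · intro A hA
      rcases Finset.mem_insert.1 hA with rfl | hA
      · exact ⟨v, Finset.mem_union_left _ hv⟩
      · exact hP.nonempty A (hRP hA)
    · rw [← hP.covers]
      constructor
      · rintro ⟨A, hA, hw⟩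
        rcases Finset.mem_insert.1 hA with rfl | hA
        · rcases Finset.mem_union.1 hw with h1 | h1
          · exact ⟨X, hX, h1⟩
          · exact ⟨Z, hZ, h1⟩
        · exact ⟨A, hRP hA, hw⟩
      · rintro ⟨A, hA, hw⟩
        obtain ⟨A', hA', hs⟩ := hcoarse A hA
        exact ⟨A', hA', hs hw⟩
  have hcard : (insert (X ∪ Z) R).card + 1 = P.card := by
    have h1 : X ∪ Z ∉ R := fun hmem => hdisj _ hmem v (Finset.mem_union_left _ hv)
      (Finset.mem_union_left _ hv)
    rw [Finset.card_insert_of_notMem h1, hR,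
      Finset.card_erase_add_one (Finset.mem_erase.2 ⟨hXZ.symm, hZ⟩),
      Finset.card_erase_add_one hX]
  have hcross : crossCount E s t (insert (X ∪ Z) R) ≤ crossCount E s t P := by
    refine Finset.card_le_card fun e he => ?_
    obtain ⟨heE, hc⟩ := Finset.mem_filter.1 he
    refine Finset.mem_filter.2 ⟨heE, ?_⟩
    obtain ⟨A, hA, hne⟩ := hc
    rcases Finset.mem_insert.1 hA with rfl | hA
    · by_contra hc
      unfold Crosses at hc
      push Not at hc
      have h1 := hc X hX
      have h2 := hc Z hZ
      simp only [Finset.mem_union] at hne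
      tauto
    · exact ⟨A, hRP hA, hne⟩
  have hfree : ∀ j, freeCount C j P ≤
      freeCount C j (insert (X ∪ Z) R) + if IsFree C j X then 1 else 0 := by
    intro j
    have h1 : {Y ∈ P | IsFree C j Y} ⊆
        {Y ∈ insert (X ∪ Z) R | IsFree C j Y} ∪ if IsFree C j X then {X} else ∅ := by
      intro Y hY
      obtain ⟨hYP, hYf⟩ := Finset.mem_filter.1 hY
      by_cases hYX : Y = X
      · subst hYX
        simp [hYf]
      · refine Finset.mem_union_left _ (Finset.mem_filter.2 ⟨Finset.mem_insert_of_mem ?_, hYf⟩)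
        have : Y ≠ Z := fun hh => hZf j (hh ▸ hYf)
        simp [hR, hYX, this, hYP]
    refine (Finset.card_le_card h1).trans ((Finset.card_union_le _ _).trans ?_)
    refine Nat.add_le_add_left ?_ _
    split_ifs <;> simp
  have hXd : ∑ j, (if IsFree C j X then 1 else 0) ≤ d := by
    rw [← Finset.card_filter]
    have h1 : ({j | IsFree C j X} : Finset ι) ⊆ (C v)ᶜ := by
      intro j hj
      exact Finset.mem_compl.2 ((Finset.mem_filter.1 hj).2 v hv)
    have h2 := Finset.card_le_card h1
    rw [Finset.card_compl] at h2
    omega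
  have hterm : ∀ j, freeCount C j P - l j ≤
      (freeCount C j (insert (X ∪ Z) R) - l j) + if IsFree C j X then 1 else 0 := by
    intro j
    have := hfree j
    omega
  have hsum := Finset.sum_le_sum fun j (_ : j ∈ Finset.univ) => hterm j
  have hM' := hC _ hM
  have hP' := hP.tight
  have hmul : d * (insert (X ∪ Z) R).card + d = d * P.card := by
    rw [← hcard, mul_add, mul_one]
  rw [Finset.sum_add_distrib] at hsum
  refine ⟨_, ⟨hM, by omega, ?_⟩, freeCount_coarse_lt hP.toIsPartition hM hcoarse hX hXf
    (Finset.mem_insert_self _ _) Finset.subset_union_left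
    (fun hh => hZf i fun w hw => hh w (Finset.mem_union_right _ hw))⟩
  by_contra hlt
  have hstrict : ∑ j, (freeCount C j P - l j) <
      ∑ j, ((freeCount C j (insert (X ∪ Z) R) - l j) + if IsFree C j X then 1 else 0) := by
    refine Finset.sum_lt_sum (fun j _ => hterm j) ⟨i, Finset.mem_univ _, ?_⟩
    have h1 := hfree i
    have := hP.le_freeCount
    rw [if_pos hXf] at h1 ⊢
    omega
  rw [Finset.sum_add_distrib] at hstrict
  omega

/-- Only the term of `i` can grow, and by at most one. A violation therefore means that there was no
slack, that this term really grew, and that the new colours destroyed no `i`-free member of `P`. -/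
theorem isCritical_of_violates {i : ι} (hi : 0 < l i) (hC : RootCondition U E s t d C l)
    {P : Finset (Finset W)} (hP : IsPartition U P) {C' : W → Finset ι}
    (hC' : ∀ j, freeCount C' j P ≤ freeCount C j P)
    (hviol : crossCount E s t P + d * P.card <
      d + ∑ j, (freeCount C' j P - Function.update l i (l i - 1) j)) :
    IsCritical U E s t d C l i P ∧ freeCount C i P ≤ freeCount C' i P := by
  have hs := Finset.add_sum_erase Finset.univ (fun j => freeCount C j P - l j) (Finset.mem_univ i)
  have hs' := Finset.add_sum_erase Finset.univ
    (fun j => freeCount C' j P - Function.update l i (l i - 1) j) (Finset.mem_univ i)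
  have hle : ∑ j ∈ Finset.univ.erase i, (freeCount C' j P - Function.update l i (l i - 1) j) ≤
      ∑ j ∈ Finset.univ.erase i, (freeCount C j P - l j) := by
    refine Finset.sum_le_sum fun j hj => ?_
    rw [Function.update_of_ne (Finset.ne_of_mem_erase hj)]
    exact Nat.sub_le_sub_right (hC' j) _
  have h1 := hC P hP
  have h2 := hC' i
  simp only [Function.update_self] at hs'
  exact ⟨⟨hP, by omega, by omega⟩, by omega⟩

/-- The first alternative, where no root is placed, is harmless because missing roots can be added
at the end. If everything fails, each critical partition has a critical coarsening with fewer
`i`-free members, which is absurd. -/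
theorem RootCondition.place {h : ℕ} (hC : RootCondition U E s t d C l)
    (hd : Fintype.card ι = h + d) {z : W} (hz : z ∈ U) (hCz : C z = Finset.univ) {i : ι}
    (hi : 0 < l i) :
    RootCondition U E s t d C (Function.update l i (l i - 1)) ∨
      ∃ v ∈ U, i ∉ C v ∧ (C v).card < h ∧
        RootCondition U E s t d (Function.update C v (insert i (C v)))
          (Function.update l i (l i - 1)) := by
  by_contra hcon
  push Not at hcon
  obtain ⟨h1, h2⟩ := hcon
  have hex : ∃ P, IsCritical U E s t d C l i P := by
    unfold RootCondition at h1
    push Not at h1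
    obtain ⟨P, hP, hlt⟩ := h1
    exact ⟨P, (isCritical_of_violates hi hC hP (fun _ => le_rfl) hlt).1⟩
  have hdesc : ∀ P, IsCritical U E s t d C l i P →
      ∃ M, IsCritical U E s t d C l i M ∧ freeCount C i M < freeCount C i P := by
    intro P hP
    have hpos : 0 < freeCount C i P := hi.trans_le hP.le_freeCount
    obtain ⟨X, hX⟩ := Finset.card_pos.1 hpos
    obtain ⟨hXP, hXf⟩ := Finset.mem_filter.1 hX
    obtain ⟨v, hv⟩ := hP.nonempty X hXP
    by_cases hfull : h ≤ (C v).card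
    · exact hP.exists_merge hC hd hz hCz hXP hXf hv hfull
    have hvU : v ∈ U := (hP.covers v).1 ⟨X, hXP, hv⟩
    have h3 := h2 v hvU (hXf v hv) (not_le.1 hfull)
    unfold RootCondition at h3
    push Not at h3
    obtain ⟨Q, hQ, hlt⟩ := h3
    have hmono : ∀ j Y, IsFree (Function.update C v (insert i (C v))) j Y → IsFree C j Y := by
      intro j Y hY w hw hj
      refine hY w hw ?_
      by_cases hwv : w = v
      · subst hwv; simp [hj]
      · simpa [hwv] using hj
    have hsub : ∀ j, {Y ∈ Q | IsFree (Function.update C v (insert i (C v))) j Y} ⊆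
        {Y ∈ Q | IsFree C j Y} := fun j Y hY =>
      Finset.mem_filter.2 ⟨(Finset.mem_filter.1 hY).1, hmono j Y (Finset.mem_filter.1 hY).2⟩
    obtain ⟨hQc, hQle⟩ := isCritical_of_violates hi hC hQ
      (fun j => Finset.card_le_card (hsub j)) hlt
    obtain ⟨Y, hY, hvY⟩ := (hQ.covers v).2 hvU
    -- Placing `i` at `v` made no member of `Q` lose its freeness, so the member containing `v`
    -- already had colour `i`. In the join it swallows the free set `X`.
    have hYf : ¬ IsFree C i Y := by
      intro hYf
      have h4 := Finset.eq_of_subset_of_card_le (hsub i) hQle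
      have h5 : Y ∈ {Y ∈ Q | IsFree C i Y} := Finset.mem_filter.2 ⟨hY, hYf⟩
      rw [← h4] at h5
      have := (Finset.mem_filter.1 h5).2 v hvY
      simp at this
    obtain ⟨M, hM, hPM, hQM⟩ := hP.exists_join hC hQc
    obtain ⟨Z, hZ, hXZ⟩ := hPM X hXP
    obtain ⟨Z', hZ', hYZ⟩ := hQM Y hY
    obtain rfl := hM.eq_of_mem Z hZ Z' hZ' v (hXZ hv) (hYZ hvY)
    exact ⟨M, hM, freeCount_coarse_lt hP.toIsPartition hM.toIsPartition hPM hXP hXf hZ hXZ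
      fun hh => hYf fun w hw => hh w (hYZ hw)⟩
  have hno : ∀ n P, IsCritical U E s t d C l i P → freeCount C i P = n → False := by
    intro n
    induction n using Nat.strong_induction_on with
    | _ n ih =>
      intro P hP hn
      obtain ⟨M, hM, hlt⟩ := hdesc P hP
      exact ih _ (hn ▸ hlt) M hM rfl
  obtain ⟨P, hP⟩ := hex
  exact hno _ P hP rfl

end Roots


/-! ### From the root condition to exact numbers of roots. -/

section Roots

variable {W β ι : Type*} [DecidableEq ι]

/-- The number of vertices in `V` of colour `i`. -/
def colourCount (V : Finset W) (C : W → Finset ι) (i : ι) : ℕ :=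
  {v ∈ V | i ∈ C v}.card

theorem sum_colourCount [Fintype ι] (V : Finset W) (C : W → Finset ι) :
    ∑ i, colourCount V C i = ∑ v ∈ V, (C v).card := by
  simp only [colourCount, Finset.card_filter]
  rw [Finset.sum_comm]
  simp

variable [DecidableEq W]

theorem colourCount_update {V : Finset W} (C : W → Finset ι) {v : W} (hv : v ∈ V) (S : Finset ι)
    (i : ι) :
    colourCount V (Function.update C v S) i + (if i ∈ C v then 1 else 0) =
      colourCount V C i + if i ∈ S then 1 else 0 := by
  unfold colourCount
  rw [Finset.card_filter, Finset.card_filter, ← Finset.add_sum_erase _ _ hv,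
    ← Finset.add_sum_erase V (fun w => if i ∈ C w then 1 else 0) hv]
  have : ∑ w ∈ V.erase v, (if i ∈ Function.update C v S w then 1 else 0) =
      ∑ w ∈ V.erase v, if i ∈ C w then 1 else 0 := by
    refine Finset.sum_congr rfl fun w hw => ?_
    rw [Function.update_of_ne (Finset.ne_of_mem_erase hw)]
  rw [this]
  simp only [Function.update_self]
  ring

theorem intersectingSupermodular_sub_card (C : W → Finset ι) (h : ℤ) :
    IntersectingSupermodular fun X => h - (X.biUnion C).card := by
  intro X Y _
  have h1 : (X ∪ Y).biUnion C = X.biUnion C ∪ Y.biUnion C := by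
    ext; simp [or_and_right, exists_or]
  have h2 : (X ∩ Y).biUnion C ⊆ X.biUnion C ∩ Y.biUnion C := by
    intro c hc
    obtain ⟨v, hv, hcv⟩ := Finset.mem_biUnion.1 hc
    exact Finset.mem_inter.2 ⟨Finset.mem_biUnion.2 ⟨v, (Finset.mem_inter.1 hv).1, hcv⟩,
      Finset.mem_biUnion.2 ⟨v, (Finset.mem_inter.1 hv).2, hcv⟩⟩
  have h3 := Finset.card_le_card h2
  have h4 := Finset.card_union_add_card_inter (X.biUnion C) (Y.biUnion C)
  simp only [h1]
  omega

variable [Fintype ι] {U : Finset W} {E : Finset β} {s t : β → W} {d : ℕ}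

theorem RootCondition.place_all {C : W → Finset ι} {l : ι → ℕ} {h : ℕ}
    (hC : RootCondition U E s t d C l) (hd : Fintype.card ι = h + d) {z : W} (hz : z ∈ U)
    (hCz : C z = Finset.univ) (hcard : ∀ v ∈ U.erase z, (C v).card ≤ h) :
    ∃ C' : W → Finset ι, RootCondition U E s t d C' (fun _ => 0) ∧ C' z = Finset.univ ∧
      (∀ v ∈ U.erase z, (C' v).card ≤ h) ∧
      ∀ i, colourCount (U.erase z) C' i ≤ colourCount (U.erase z) C i + l i := by
  induction hn : ∑ i, l i using Nat.strong_induction_on generalizing C l with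
  | _ n ih =>
    by_cases hl : ∀ i, l i = 0
    · obtain rfl : l = fun _ => 0 := funext hl
      exact ⟨C, hC, hCz, hcard, fun i => le_rfl⟩
    push Not at hl
    obtain ⟨i, hi⟩ := hl
    have hi : 0 < l i := Nat.pos_of_ne_zero hi
    have hle : ∀ j, Function.update l i (l i - 1) j ≤ l j := by
      intro j
      by_cases hj : j = i
      · subst hj; simp
      · simp [hj]
    have hlt : ∑ j, Function.update l i (l i - 1) j < n := by
      rw [← hn]
      exact Finset.sum_lt_sum (fun j _ => hle j) ⟨i, Finset.mem_univ _, by simp; omega⟩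
    rcases hC.place hd hz hCz hi with h1 | ⟨v, hv, hiv, hvh, h1⟩
    · obtain ⟨C', h2, h3, h4, h5⟩ := ih _ hlt h1 hCz hcard rfl
      exact ⟨C', h2, h3, h4, fun j => (h5 j).trans (Nat.add_le_add_left (hle j) _)⟩
    · have hvz : v ≠ z := by
        rintro rfl
        simp [hCz] at hiv
      obtain ⟨C', h2, h3, h4, h5⟩ := ih _ hlt h1 (by simpa [hvz.symm] using hCz) (by
        intro w hw
        by_cases hwv : w = v
        · subst hwv
          simp only [Function.update_self, Finset.card_insert_of_notMem hiv]
          omega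
        · simpa [hwv] using hcard w hw) rfl
      refine ⟨C', h2, h3, h4, fun j => (h5 j).trans ?_⟩
      have h6 := colourCount_update C (Finset.mem_erase.2 ⟨hvz, hv⟩) (insert i (C v)) j
      by_cases hj : j = i
      · subst hj
        simp [hiv] at h6 ⊢
        omega
      · simp [hj] at h6 ⊢
        omega

/-- Complete `P` by the uncovered rest, which contains `z`. This class has no free colour, and it
adds no crossing edge; its share `d` on the right cancels the `d` on the left. -/
theorem RootCondition.sum_le {C : W → Finset ι} {h : ℕ}
    (hC : RootCondition U E s t d C (fun _ => 0)) (hd : Fintype.card ι = h + d) {z : W}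
    (hz : z ∈ U) (hCz : C z = Finset.univ) (hE : ∀ e ∈ E, s e ∈ U ∧ t e ∈ U)
    {P : Finset (Finset W)} (hP : IsSubpartition P) (hPU : ∀ X ∈ P, X ⊆ U.erase z) :
    ∑ X ∈ P, ((h : ℤ) - (X.biUnion C).card) ≤ crossCount E s t P := by
  set Z := U \ P.biUnion id with hZ
  have hmemZ : ∀ w, w ∈ Z ↔ w ∈ U ∧ ¬ ∃ X ∈ P, w ∈ X := by simp [hZ]
  have hPU' : ∀ w, (∃ X ∈ P, w ∈ X) → w ∈ U := by
    rintro w ⟨X, hX, hw⟩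
    exact Finset.mem_of_mem_erase (hPU X hX hw)
  have hzZ : z ∈ Z := (hmemZ z).2 ⟨hz, fun ⟨X, hX, hzX⟩ =>
    Finset.notMem_erase z U (hPU X hX hzX)⟩
  have hZP : Z ∉ P := fun hmem => ((hmemZ z).1 hzZ).2 ⟨Z, hmem, hzZ⟩
  have hpart : IsPartition U (insert Z P) := by
    refine ⟨⟨?_, ?_⟩, fun w => ?_⟩
    · intro A hA B hB w hwA hwB
      rcases Finset.mem_insert.1 hA with rfl | hA <;> rcases Finset.mem_insert.1 hB with rfl | hB
      · rfl
      · exact absurd ⟨B, hB, hwB⟩ ((hmemZ w).1 hwA).2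
      · exact absurd ⟨A, hA, hwA⟩ ((hmemZ w).1 hwB).2
      · exact hP.eq_of_mem A hA B hB w hwA hwB
    · intro A hA
      rcases Finset.mem_insert.1 hA with rfl | hA
      · exact ⟨z, hzZ⟩
      · exact hP.nonempty A hA
    · simp only [Finset.mem_insert, or_and_right, exists_or, exists_eq_left, hmemZ]
      exact ⟨fun hh => hh.elim (·.1) (hPU' w), fun hw => (em _).symm.imp_left fun hn => ⟨hw, hn⟩⟩
  have hcross : crossCount E s t (insert Z P) ≤ crossCount E s t P := by
    refine Finset.card_le_card fun e he => ?_
    obtain ⟨heE, A, hA, hne⟩ := Finset.mem_filter.1 he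
    refine Finset.mem_filter.2 ⟨heE, ?_⟩
    rcases Finset.mem_insert.1 hA with rfl | hA
    · by_contra hc
      rw [hP.not_crosses_iff] at hc
      rw [hmemZ, hmemZ] at hne
      have := hE e heE
      rcases hc with ⟨X, hX, h1, h2⟩ | hc
      · exact hne ⟨fun hh => absurd ⟨X, hX, h1⟩ hh.2, fun hh => absurd ⟨X, hX, h2⟩ hh.2⟩
      · tauto
    · exact ⟨A, hA, hne⟩
  have hcount : ∀ X : Finset W, (∑ i, if IsFree C i X then 1 else 0) + (X.biUnion C).card =
      Fintype.card ι := by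
    intro X
    have h1 : ({i | IsFree C i X} : Finset ι) = (X.biUnion C)ᶜ := by
      ext i
      rw [Finset.mem_filter, Finset.mem_compl]
      simp [IsFree]
    rw [← Finset.card_filter, h1, Finset.card_compl_add_card]
  have h1 := hC _ hpart
  have h2 : ∑ i, (freeCount C i (insert Z P) - 0) =
      ∑ X ∈ P, ∑ i, if IsFree C i X then 1 else 0 := by
    rw [Finset.sum_comm]
    refine Finset.sum_congr rfl fun i _ => ?_
    rw [← Finset.card_filter, Nat.sub_zero, freeCount, Finset.filter_insert, if_neg]
    exact fun hh => hh z hzZ (by simp [hCz])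
  rw [h2, Finset.card_insert_of_notMem hZP] at h1
  have h3 : ∑ X ∈ P, ((h : ℤ) - (X.biUnion C).card) =
      ∑ X ∈ P, (((∑ i, if IsFree C i X then 1 else 0 : ℕ) : ℤ) - d) := by
    refine Finset.sum_congr rfl fun X _ => ?_
    have := hcount X
    omega
  rw [h3, Finset.sum_sub_distrib, ← Nat.cast_sum, Finset.sum_const, nsmul_eq_mul]
  rw [mul_add, mul_one, mul_comm] at h1
  zify at h1 hcross
  push_cast at h1 ⊢
  linarith

/-- Roots can be added to a set of roots that is sufficient for a packing, and moved, until the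
numbers of roots of the single colours are as prescribed. -/
theorem exists_colourCount_eq {V : Finset W} {C : W → Finset ι} {h : ℕ} {l : ι → ℕ}
    (r : Finset W → ℕ) (hcard : ∀ v ∈ V, (C v).card ≤ h) (hcount : ∀ i, colourCount V C i ≤ l i)
    (hcov : ∀ X ⊆ V, X.Nonempty → h ≤ r X + (X.biUnion C).card) (hlV : ∀ i, l i ≤ V.card)
    (hsum : ∑ i, l i ≤ h * V.card) :
    ∃ C' : W → Finset ι, (∀ v ∈ V, (C' v).card ≤ h) ∧ (∀ i, colourCount V C' i = l i) ∧
      ∀ X ⊆ V, X.Nonempty → h ≤ r X + (X.biUnion C').card := by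
  induction hn : ∑ i, (l i - colourCount V C i) using Nat.strong_induction_on generalizing C with
  | _ n ih =>
    by_cases hall : ∀ i, colourCount V C i = l i
    · exact ⟨C, hcard, hall, hcov⟩
    push Not at hall
    obtain ⟨i, hi⟩ := hall
    have hi : colourCount V C i < l i := lt_of_le_of_ne (hcount i) hi
    have finish : ∀ C' : W → Finset ι, (∀ v ∈ V, (C' v).card ≤ h) →
        (∀ j, colourCount V C' j = colourCount V C j + if j = i then 1 else 0) →
        (∀ X ⊆ V, X.Nonempty → h ≤ r X + (X.biUnion C').card) →
        ∃ C' : W → Finset ι, (∀ v ∈ V, (C' v).card ≤ h) ∧ (∀ i, colourCount V C' i = l i) ∧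
          ∀ X ⊆ V, X.Nonempty → h ≤ r X + (X.biUnion C').card := by
      intro C' h1 h2 h3
      refine ih _ ?_ h1 (fun j => ?_) h3 rfl
      · rw [← hn]
        refine Finset.sum_lt_sum (fun j _ => ?_) ⟨i, Finset.mem_univ _, ?_⟩
        · rw [h2]; omega
        · rw [h2, if_pos rfl]; omega
      · rw [h2]
        split_ifs with hj
        · subst hj; omega
        · exact hcount j
    by_cases hv : ∃ v ∈ V, i ∉ C v ∧ (C v).card < h
    · obtain ⟨v, hv, hiv, hlt⟩ := hv
      refine finish (Function.update C v (insert i (C v))) (fun w hw => ?_) (fun j => ?_)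
        fun X hX hne => (hcov X hX hne).trans ?_
      · by_cases hwv : w = v
        · subst hwv
          rw [Function.update_self, Finset.card_insert_of_notMem hiv]
          omega
        · simpa [hwv] using hcard w hw
      · have h6 := colourCount_update C hv (insert i (C v)) j
        by_cases hj : j = i
        · subst hj; simpa [hiv] using h6
        · simpa [hj] using h6
      · refine Nat.add_le_add_left (Finset.card_le_card (Finset.biUnion_mono fun w _ => ?_)) _
        by_cases hwv : w = v
        · subst hwv; simp
        · simp [hwv]
    push Not at hv
    obtain ⟨v, hvV, hiv⟩ : ∃ v ∈ V, i ∉ C v := by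
      by_contra hcon
      push Not at hcon
      have : colourCount V C i = V.card := by
        rw [colourCount, Finset.filter_true_of_mem hcon]
      have := hlV i
      omega
    have hvfull : (C v).card = h := le_antisymm (hcard v hvV) (hv v hvV hiv)
    obtain ⟨w, hwV, hw⟩ : ∃ w ∈ V, (C w).card < h := by
      by_contra hcon
      push Not at hcon
      have h1 : V.card * h ≤ ∑ w ∈ V, (C w).card := by
        rw [← smul_eq_mul]
        exact Finset.card_nsmul_le_sum _ _ _ hcon
      rw [← sum_colourCount] at h1
      have h2 : ∑ j, colourCount V C j < ∑ j, l j :=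
        Finset.sum_lt_sum (fun j _ => hcount j) ⟨i, Finset.mem_univ _, hi⟩
      rw [mul_comm] at h1
      omega
    have hiw : i ∈ C w := by
      by_contra hiw
      have := hv w hwV hiw
      omega
    -- No vertex with room lacks `i`: `v` lacks `i` and is full, `w` has room and has `i`. At `v`
    -- replace some `j` by `i`, and hand `j` to `w`. Sets containing `v` stay covered by the `h`
    -- colours of `v` alone; the others lose nothing.
    obtain ⟨j, hjv, hjw⟩ : ∃ j ∈ C v, j ∉ C w := by
      by_contra hcon
      push Not at hcon
      have := Finset.card_le_card (show C v ⊆ C w from hcon)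
      omega
    have hwv : w ≠ v := fun hh => hiv (hh ▸ hiw)
    have hij : i ≠ j := fun hh => hiv (hh ▸ hjv)
    set S := insert i ((C v).erase j) with hS
    have hScard : S.card = h := by
      rw [hS, Finset.card_insert_of_notMem (by simp [hiv]), Finset.card_erase_add_one hjv, hvfull]
    refine finish (Function.update (Function.update C v S) w (insert j (C w))) (fun x hx => ?_)
      (fun c => ?_) fun X hX hne => ?_
    · by_cases hxw : x = w
      · subst hxw
        rw [Function.update_self, Finset.card_insert_of_notMem hjw]
        omega
      rw [Function.update_of_ne hxw]
      by_cases hxv : x = v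
      · subst hxv
        rw [Function.update_self, hScard]
      · rw [Function.update_of_ne hxv]
        exact hcard x hx
    · have h1 := colourCount_update C hvV S c
      have h2 := colourCount_update (Function.update C v S) hwV (insert j (C w)) c
      rw [Function.update_of_ne hwv] at h2
      by_cases hci : c = i
      · subst hci
        simp [hS, hiv, hiw] at h1 h2 ⊢
        omega
      by_cases hcj : c = j
      · subst hcj
        simp [hS, hjv, hjw, hij.symm] at h1 h2 ⊢
        omega
      · simp [hS, hci, hcj] at h1 h2 ⊢
        omega
    · by_cases hvX : v ∈ X
      · have h1 : S ⊆ X.biUnion (Function.update (Function.update C v S) w (insert j (C w))) := by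
          intro c hc
          refine Finset.mem_biUnion.2 ⟨v, hvX, ?_⟩
          rwa [Function.update_of_ne hwv.symm, Function.update_self]
        have := Finset.card_le_card h1
        omega
      · refine (hcov X hX hne).trans (Nat.add_le_add_left (Finset.card_le_card
          (Finset.biUnion_mono fun x hx => ?_)) _)
        by_cases hxw : x = w
        · subst hxw; simp
        · have hxv : x ≠ v := fun hh => hvX (hh ▸ hx)
          simp [hxw, hxv]

end Roots

/-! ### Packing branchings with given roots -/

section Branchings

variable {W β ι : Type*} [DecidableEq W] [DecidableEq ι]

/-- The number of arcs in `E` that enter `X`, where the arc `e` goes from `a e` to `b e`. -/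
def inDegree (E : Finset β) (a b : β → W) (X : Finset W) : ℕ :=
  {e ∈ E | a e ∉ X ∧ b e ∈ X}.card

theorem inDegree_union_add_inter (E : Finset β) (a b : β → W) (X Y : Finset W) :
    inDegree E a b (X ∪ Y) + inDegree E a b (X ∩ Y) ≤ inDegree E a b X + inDegree E a b Y := by
  simp only [inDegree, Finset.card_filter, ← Finset.sum_add_distrib]
  refine Finset.sum_le_sum fun e _ => ?_
  by_cases h1 : a e ∈ X <;> by_cases h2 : a e ∈ Y <;> by_cases h3 : b e ∈ X <;>
    by_cases h4 : b e ∈ Y <;> simp [h1, h2, h3, h4]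

theorem inDegree_erase [DecidableEq β] {E : Finset β} {e : β} (he : e ∈ E) (a b : β → W)
    (X : Finset W) :
    inDegree (E.erase e) a b X + (if a e ∉ X ∧ b e ∈ X then 1 else 0) = inDegree E a b X := by
  simp only [inDegree, Finset.card_filter]
  exact Finset.sum_erase_add _ _ he

/-- For every non-empty subset `X` of `V`, the colours in `X` and the arcs entering `X` are at
least `h` in number. -/
def CoverCondition (V : Finset W) (E : Finset β) (a b : β → W) (h : ℕ) (C : W → Finset ι) : Prop :=
  ∀ X ⊆ V, X.Nonempty → h ≤ inDegree E a b X + (X.biUnion C).card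

variable {V : Finset W} {E : Finset β} {a b : β → W} {h : ℕ} {C : W → Finset ι}

/-- A set for which the cover condition holds with equality. -/
structure IsTight (V : Finset W) (E : Finset β) (a b : β → W) (h : ℕ) (C : W → Finset ι)
    (X : Finset W) : Prop where
  subset : X ⊆ V
  eq : inDegree E a b X + (X.biUnion C).card = h

/-- In-degree and number of colours are both submodular, so equality holds throughout; equality for
the colours is the second assertion. -/
theorem IsTight.inter (hC : CoverCondition V E a b h C) {X Y : Finset W}
    (hX : IsTight V E a b h C X) (hY : IsTight V E a b h C Y) (hXY : (X ∩ Y).Nonempty) :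
    IsTight V E a b h C (X ∩ Y) ∧ X.biUnion C ∩ Y.biUnion C ⊆ (X ∩ Y).biUnion C := by
  have h0 := inDegree_union_add_inter E a b X Y
  have h1 : (X ∪ Y).biUnion C = X.biUnion C ∪ Y.biUnion C := by
    ext; simp [or_and_right, exists_or]
  have h2 : (X ∩ Y).biUnion C ⊆ X.biUnion C ∩ Y.biUnion C := by
    intro c hc
    obtain ⟨v, hv, hcv⟩ := Finset.mem_biUnion.1 hc
    exact Finset.mem_inter.2 ⟨Finset.mem_biUnion.2 ⟨v, (Finset.mem_inter.1 hv).1, hcv⟩,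
      Finset.mem_biUnion.2 ⟨v, (Finset.mem_inter.1 hv).2, hcv⟩⟩
  have h3 := Finset.card_le_card h2
  have h4 := Finset.card_union_add_card_inter (X.biUnion C) (Y.biUnion C)
  have h5 := hC (X ∩ Y) (Finset.inter_subset_left.trans hX.subset) hXY
  have h6 := hC (X ∪ Y) (Finset.union_subset hX.subset hY.subset)
    (hXY.mono (Finset.inter_subset_left.trans Finset.subset_union_left))
  have h7 := hX.eq
  have h8 := hY.eq
  rw [h1] at h6
  refine ⟨⟨Finset.inter_subset_left.trans hX.subset, by omega⟩, ?_⟩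
  rw [Finset.eq_of_subset_of_card_le h2 (by omega)]

/-- If some vertex has fewer than `h` colours, then the colours can be extended along an arc
without violating the cover condition. -/
theorem CoverCondition.exists_arc [DecidableEq β] (hC : CoverCondition V E a b h C)
    (hE : ∀ e ∈ E, a e ∈ V ∧ b e ∈ V)
    (hex : ∃ v ∈ V, (C v).card < h) :
    ∃ e ∈ E, ∃ c ∈ C (a e), c ∉ C (b e) ∧ (C (b e)).card < h ∧
      CoverCondition V (E.erase e) a b h (Function.update C (b e) (insert c (C (b e)))) := by
  by_contra hcon
  push Not at hcon
  -- The condition can only fail at a set that `e` enters, that was tight, and that gains no colour,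
  -- hence already contains `c`.
  have hviol : ∀ e ∈ E, ∀ c ∈ C (a e), c ∉ C (b e) → (C (b e)).card < h →
      ∃ Z, IsTight V E a b h C Z ∧ b e ∈ Z ∧ a e ∉ Z ∧ c ∈ Z.biUnion C := by
    intro e he c hca hcb hlt
    have h1 := hcon e he c hca hcb hlt
    unfold CoverCondition at h1
    push Not at h1
    obtain ⟨Z, hZ, hne, hlt⟩ := h1
    have h2 := hC Z hZ hne
    have h3 := inDegree_erase he a b Z
    have h4 : Z.biUnion C ⊆ Z.biUnion (Function.update C (b e) (insert c (C (b e)))) := by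
      refine Finset.biUnion_mono fun w _ => ?_
      by_cases hw : w = b e
      · subst hw; simp
      · simp [hw]
    have h5 := Finset.card_le_card h4
    by_cases hent : a e ∉ Z ∧ b e ∈ Z
    · rw [if_pos hent] at h3
      refine ⟨Z, ⟨hZ, by omega⟩, hent.2, hent.1, ?_⟩
      have h6 := Finset.eq_of_subset_of_card_le h4 (by omega)
      rw [h6]
      exact Finset.mem_biUnion.2 ⟨b e, hent.2, by simp⟩
    · rw [if_neg hent] at h3
      omega
  -- The vertices of `X` whose colours lie in `C v` show at most `|C v|` colours, so more arcs enter
  -- this subset than enter `X`; one of them starts inside `X`.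
  have harc : ∀ X ⊆ V, ∀ v ∈ X, inDegree E a b X + (C v).card < h →
      ∃ e ∈ E, a e ∈ X ∧ b e ∈ X ∧ ¬ C (a e) ⊆ C v ∧ C (b e) ⊆ C v := by
    intro X hX v hv hlt
    have h1 := hC {w ∈ X | C w ⊆ C v} ((Finset.filter_subset _ _).trans hX)
      ⟨v, by simp [hv]⟩
    have h2 : ({w ∈ X | C w ⊆ C v}.biUnion C).card ≤ (C v).card := by
      refine Finset.card_le_card fun c hc => ?_
      obtain ⟨w, hw, hcw⟩ := Finset.mem_biUnion.1 hc
      exact (Finset.mem_filter.1 hw).2 hcw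
    by_contra hno
    push Not at hno
    have h3 : inDegree E a b {w ∈ X | C w ⊆ C v} ≤ inDegree E a b X := by
      refine Finset.card_le_card fun e he => ?_
      obtain ⟨heE, ha, hb⟩ := Finset.mem_filter.1 he
      obtain ⟨hbX, hbv⟩ := Finset.mem_filter.1 hb
      refine Finset.mem_filter.2 ⟨heE, fun haX => ?_, hbX⟩
      refine hno e heE haX hbX (fun hh => ha (Finset.mem_filter.2 ⟨haX, hh⟩)) hbv
    omega
  have hnext : ∀ X ⊆ V, ∀ v ∈ X, inDegree E a b X + (C v).card < h →
      ∃ Z, IsTight V E a b h C Z ∧ ∃ u ∈ X, u ∉ Z ∧ ∃ w ∈ X ∩ Z, ∃ c ∈ C u,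
        c ∈ Z.biUnion C ∧ c ∉ C w := by
    intro X hX v hv hlt
    obtain ⟨e, he, haX, hbX, hav, hbv⟩ := harc X hX v hv hlt
    obtain ⟨c, hca, hcv⟩ := Finset.not_subset.1 hav
    have hcb : c ∉ C (b e) := fun hh => hcv (hbv hh)
    obtain ⟨Z, hZ, hbZ, haZ, hcZ⟩ := hviol e he c hca hcb
      ((Finset.card_le_card hbv).trans_lt (by omega))
    exact ⟨Z, hZ, a e, haX, haZ, b e, Finset.mem_inter.2 ⟨hbX, hbZ⟩, c, hca, hcZ, hcb⟩
  have hfin : ∀ Y, IsTight V E a b h C Y → ∀ w ∈ Y, ∀ c ∈ Y.biUnion C, c ∉ C w →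
      inDegree E a b Y + (C w).card < h := by
    intro Y hY w hw c hcY hcw
    have h1 : C w ⊂ Y.biUnion C :=
      (Finset.ssubset_iff_of_subset fun x hx => Finset.mem_biUnion.2 ⟨_, hw, hx⟩).2 ⟨c, hcY, hcw⟩
    have h2 := Finset.card_lt_card h1
    have := hY.eq
    omega
  -- Descent on tight sets: the blocking set `Z` misses the tail `u`, so `X ∩ Z` is a smaller tight
  -- set. It still contains the colour `c`, which the head `w` lacks.
  have hno : ∀ n X, IsTight V E a b h C X → X.card = n → ∀ v ∈ X,
      inDegree E a b X + (C v).card < h → False := by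
    intro n
    induction n using Nat.strong_induction_on with
    | _ n ih =>
      intro X hX hn v hv hlt
      obtain ⟨Z, hZ, u, hu, huZ, w, hw, c, hcu, hcZ, hcw⟩ := hnext X hX.subset v hv hlt
      obtain ⟨h1, h2⟩ := hX.inter hC hZ ⟨w, hw⟩
      have h3 : X ∩ Z ⊂ X := (Finset.ssubset_iff_of_subset Finset.inter_subset_left).2
        ⟨u, hu, fun hh => huZ (Finset.mem_inter.1 hh).2⟩
      exact ih _ (hn ▸ Finset.card_lt_card h3) _ h1 rfl w hw (hfin _ h1 w hw c
        (h2 (Finset.mem_inter.2 ⟨Finset.mem_biUnion.2 ⟨u, hu, hcu⟩, hcZ⟩)) hcw)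
  obtain ⟨v, hv, hlt⟩ := hex
  -- The descent starts from `V`, which need not be tight but has no entering arc.
  have hV : inDegree E a b V = 0 := by
    refine Finset.card_eq_zero.2 (Finset.filter_eq_empty_iff.2 fun e he hh => ?_)
    exact hh.1 (hE e he).1
  obtain ⟨Z, hZ, u, -, -, w, hw, c, -, hcZ, hcw⟩ := hnext V subset_rfl v hv (by omega)
  exact hno _ Z hZ rfl w (Finset.mem_inter.1 hw).2
    (hfin Z hZ w (Finset.mem_inter.1 hw).2 c hcZ hcw)

end Branchings


/-! ### Attaching a leaf to a forest -/

section Leaf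

variable {α β : Type*}

theorem reachableSet_subset {H : Graph α β} {x : α} (hx : x ∈ H.vertexSet) :
    reachableSet H x ⊆ H.vertexSet := by
  intro y hy
  rcases Relation.ReflTransGen.cases_tail hy with rfl | ⟨z, -, hz⟩
  · exact hx
  · exact hz.right_mem

theorem reachableSet_eq_of_adj {H : Graph α β} {x y : α} (h : H.Adj x y) :
    reachableSet H x = reachableSet H y := by
  ext z
  exact ⟨fun hz => Relation.ReflTransGen.head h.symm hz, fun hz => Relation.ReflTransGen.head h hz⟩

/-- The graph `H` together with a further edge `e` from a vertex `u` of `H` to `v`. -/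
def addEdge (H : Graph α β) {e : β} {u : α} (hu : u ∈ H.vertexSet) (he : e ∉ H.edgeSet) (v : α) :
    Graph α β where
  vertexSet := insert v H.vertexSet
  IsLink f x y := H.IsLink f x y ∨ f = e ∧ (x = u ∧ y = v ∨ x = v ∧ y = u)
  isLink_symm := fun f _ => ⟨fun x y h => by
    rcases h with h | ⟨h, h'⟩
    · exact .inl h.symm
    · exact .inr ⟨h, by tauto⟩⟩
  eq_or_eq_of_isLink_of_isLink := by
    rintro f x y x' y' (h | ⟨rfl, h⟩) (h' | ⟨h1, h'⟩)
    · exact h.left_eq_or_eq h'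
    · exact absurd (h1 ▸ h.edge_mem) he
    · exact absurd h'.edge_mem he
    · rcases h with ⟨rfl, rfl⟩ | ⟨rfl, rfl⟩ <;> rcases h' with ⟨rfl, rfl⟩ | ⟨rfl, rfl⟩ <;> simp
  left_mem_of_isLink := by
    rintro f x y (h | ⟨-, ⟨rfl, -⟩ | ⟨rfl, -⟩⟩)
    · exact .inr h.left_mem
    · exact .inr hu
    · exact .inl rfl

variable {H : Graph α β} {e : β} {u v : α} {hu : u ∈ H.vertexSet} {he : e ∉ H.edgeSet}

theorem addEdge_edgeSet : (addEdge H hu he v).edgeSet = insert e H.edgeSet := by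
  ext f
  constructor
  · rintro ⟨x, y, h | ⟨rfl, -⟩⟩
    · exact .inr h.edge_mem
    · exact .inl rfl
  · rintro (rfl | h)
    · exact ⟨u, v, .inr ⟨rfl, .inl ⟨rfl, rfl⟩⟩⟩
    · obtain ⟨x, y, h⟩ := H.exists_isLink_of_mem_edgeSet h
      exact ⟨x, y, .inl h⟩

theorem addEdge_le {G : Graph α β} (hH : H ≤ G) (h : G.IsLink e u v) : addEdge H hu he v ≤ G := by
  refine ⟨?_, ?_⟩
  · rintro x (rfl | hx)
    · exact h.right_mem
    · exact hH.vertexSet_mono hx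
  · rintro f x y (h' | ⟨rfl, ⟨rfl, rfl⟩ | ⟨rfl, rfl⟩⟩)
    · exact h'.mono hH
    · exact h
    · exact h.symm

/-- A cycle through `v` would use `e` for both of its edges at `v`. Its edges being distinct, it
would be a loop, but `u ≠ v`. -/
theorem IsForest.addEdge (hH : IsForest H) (hv : v ∉ H.vertexSet) :
    IsForest (addEdge H hu he v) := by
  rintro n x f ⟨hx, hf, hlink⟩
  have huv : u ≠ v := fun h => hv (h ▸ hu)
  have hinc : ∀ i, x i = v ∨ x (i + 1) = v → f i = e := by
    intro i hi
    rcases hlink i with h | h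
    · rcases hi with hi | hi
      · exact absurd (hi ▸ h.left_mem) hv
      · exact absurd (hi ▸ h.right_mem) hv
    · exact h.1
  have hno : ∀ i, x i ≠ v := by
    intro i hi
    have h1 := hinc i (.inl hi)
    have h2 := hinc (i - 1) (.inr (by rwa [sub_add_cancel]))
    have h3 : i + 1 = i := by
      have := hf (h2.trans h1.symm)
      nth_rewrite 1 [← this]
      exact sub_add_cancel i 1
    rcases hlink i with h | ⟨-, h | h⟩
    · exact hv (hi ▸ h.left_mem)
    · exact huv (h.1.symm.trans hi)
    · rw [h3] at h
      exact huv (h.2.symm.trans hi)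
  refine hH n x f ⟨hx, hf, fun i => ?_⟩
  rcases hlink i with h | ⟨-, h | h⟩
  · exact h
  · exact absurd h.2 (hno _)
  · exact absurd h.1 (hno _)

theorem mem_reachableSet_addEdge {x : α} (hx : x ∈ H.vertexSet) (hv : v ∉ H.vertexSet) (y : α) :
    y ∈ reachableSet (addEdge H hu he v) x ↔
      y ∈ reachableSet H x ∨ y = v ∧ u ∈ reachableSet H x := by
  have huv : u ≠ v := fun h => hv (h ▸ hu)
  have hmono : ∀ y, y ∈ reachableSet H x → y ∈ reachableSet (addEdge H hu he v) x := fun y hy =>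
    Relation.ReflTransGen.mono (r := H.Adj) (fun a b ⟨f, hf⟩ => ⟨f, .inl hf⟩) x y hy
  constructor
  · intro hy
    induction hy with
    | refl => exact .inl .refl
    | tail _ hyz ih =>
      obtain ⟨f, h | ⟨-, ⟨rfl, rfl⟩ | ⟨rfl, rfl⟩⟩⟩ := hyz
      · rcases ih with ih | ⟨rfl, -⟩
        · exact .inl (ih.tail ⟨f, h⟩)
        · exact absurd h.left_mem hv
      · exact .inr ⟨rfl, ih.resolve_right fun h => huv h.1⟩
      · rcases ih with ih | ih
        · exact absurd (reachableSet_subset hx ih) hv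
        · exact .inl ih.2
  · rintro (hy | ⟨rfl, hy⟩)
    · exact hmono y hy
    · exact (hmono u hy).tail ⟨e, .inr ⟨rfl, .inl ⟨rfl, rfl⟩⟩⟩

theorem numComponents_addEdge (hv : v ∉ H.vertexSet) :
    numComponents (addEdge H hu he v) = numComponents H := by
  classical
  -- The new vertex enters the component of `u`; deleting `v` inverts this map.
  set φ : Set α → Set α := fun S => if u ∈ S then insert v S else S with hφ
  have hreach : ∀ x ∈ H.vertexSet,
      reachableSet (addEdge H hu he v) x = φ (reachableSet H x) := by
    intro x hx
    ext y
    rw [mem_reachableSet_addEdge hx hv]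
    by_cases h : u ∈ reachableSet H x
    · simp [hφ, h, or_comm]
    · simp [hφ, h]
  have himage : components (addEdge H hu he v) = φ '' components H := by
    ext S
    constructor
    · rintro ⟨x, rfl | hx, rfl⟩
      · have hadj : (addEdge H hu he x).Adj x u := ⟨e, .inr ⟨rfl, .inr ⟨rfl, rfl⟩⟩⟩
        exact ⟨_, ⟨u, hu, rfl⟩, by rw [reachableSet_eq_of_adj hadj, hreach u hu]⟩
      · exact ⟨_, ⟨x, hx, rfl⟩, (hreach x hx).symm⟩
    · rintro ⟨_, ⟨x, hx, rfl⟩, rfl⟩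
      exact ⟨x, .inr hx, (hreach x hx).symm⟩
  have hdel : ∀ S ∈ components H, φ S \ {v} = S := by
    rintro _ ⟨x, hx, rfl⟩
    have hvS : v ∉ reachableSet H x := fun h => hv (reachableSet_subset hx h)
    simp only [hφ]
    split_ifs <;> simp [hvS]
  have hinj : Set.InjOn φ (components H) := fun S hS T hT hST => by
    rw [← hdel S hS, ← hdel T hT, hST]
  rw [numComponents, numComponents, himage, hinj.ncard_image]

theorem isForest_noEdge (S : Set α) : IsForest (Graph.noEdge S β) := by
  rintro n x f ⟨-, -, h⟩
  exact absurd (h 0) (by simp)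

theorem numComponents_noEdge (S : Set α) : numComponents (Graph.noEdge S β) = S.ncard := by
  have h1 : ∀ x, reachableSet (Graph.noEdge S β) x = {x} := by
    intro x
    ext y
    refine ⟨fun hy => ?_, fun hy => hy ▸ .refl⟩
    rcases Relation.ReflTransGen.cases_tail hy with rfl | ⟨z, -, f, hz⟩
    · rfl
    · simp at hz
  have h2 : components (Graph.noEdge S β) = (fun x => {x}) '' S := by
    ext T
    simp [components, h1, eq_comm]
  rw [numComponents, h2, Set.ncard_image_of_injective _ Set.singleton_injective]

end Leaf

/-! ### Growing the forests from their roots. -/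

section Packing

variable {α β ι : Type*} [DecidableEq α] [DecidableEq ι]

/-- Under the cover condition, edge-disjoint forests extend to forests with the same numbers of
components such that every vertex belongs to exactly `h` of them. -/
theorem CoverCondition.exists_packing {G : Graph α β} {V : Finset α} (hV : ↑V = G.vertexSet)
    {R : Finset β} {a b : β → α} (hlink : ∀ e ∈ R, G.IsLink e (a e) (b e)) {h : ℕ}
    {C : α → Finset ι} (hcov : CoverCondition V R a b h C) (hcard : ∀ v ∈ V, (C v).card ≤ h)
    (F : ι → Graph α β) (hC : ∀ v i, i ∈ C v ↔ v ∈ (F i).vertexSet) (hle : ∀ i, F i ≤ G)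
    (hforest : ∀ i, IsForest (F i))
    (hdisj : ∀ i j, i ≠ j → Disjoint (F i).edgeSet (F j).edgeSet)
    (hR : ∀ i, ∀ e ∈ R, e ∉ (F i).edgeSet) :
    ∃ (F' : ι → Graph α β) (C' : α → Finset ι), (∀ v i, i ∈ C' v ↔ v ∈ (F' i).vertexSet) ∧
      (∀ i, F' i ≤ G) ∧ (∀ i, IsForest (F' i)) ∧
      (∀ i j, i ≠ j → Disjoint (F' i).edgeSet (F' j).edgeSet) ∧
      (∀ v ∈ V, (C' v).card = h) ∧ ∀ i, numComponents (F' i) = numComponents (F i) := by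
  classical
  induction hn : R.card using Nat.strong_induction_on generalizing R C F with
  | _ n ih =>
    by_cases hfull : ∀ v ∈ V, (C v).card = h
    · exact ⟨F, C, hC, hle, hforest, hdisj, hfull, fun _ => rfl⟩
    push Not at hfull
    obtain ⟨v, hv, hne⟩ := hfull
    have hmem : ∀ x, x ∈ V ↔ x ∈ G.vertexSet := fun x => by rw [← hV]; simp
    obtain ⟨e, he, c, hca, hcb, hlt, hcov'⟩ := hcov.exists_arc
      (fun e he => ⟨(hmem _).2 (hlink e he).left_mem, (hmem _).2 (hlink e he).right_mem⟩)
      ⟨v, hv, lt_of_le_of_ne (hcard v hv) hne⟩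
    have hu := (hC _ _).1 hca
    have hw : b e ∉ (F c).vertexSet := fun hh => hcb ((hC _ _).2 hh)
    set K := addEdge (F c) hu (hR c e he) (b e) with hK
    have hKe : K.edgeSet = insert e (F c).edgeSet := addEdge_edgeSet
    have hdisjK : ∀ j, j ≠ c → Disjoint K.edgeSet (F j).edgeSet := by
      intro j hj
      rw [hKe, Set.disjoint_insert_left]
      exact ⟨hR j e he, hdisj c j hj.symm⟩
    obtain ⟨F', C', h1, h2, h3, h4, h5, h6⟩ := ih (R.erase e).card
      (hn ▸ Finset.card_erase_lt_of_mem he)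
      (fun f hf => hlink f (Finset.mem_of_mem_erase hf)) hcov' (fun x hx => by
        by_cases hxb : x = b e
        · subst hxb
          rw [Function.update_self, Finset.card_insert_of_notMem hcb]
          omega
        · simpa [hxb] using hcard x hx)
      (Function.update F c K) (fun x i => by
        by_cases hi : i = c
        · subst hi
          rw [Function.update_self]
          by_cases hx : x = b e
          · subst hx
            simp [hK, addEdge]
          · simp [hK, addEdge, hx, hC]
        · rw [Function.update_of_ne hi]
          by_cases hx : x = b e
          · subst hx
            simp [hi, hC]
          · simp [hx, hC])
      (fun i => by
        by_cases hi : i = c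
        · subst hi
          rw [Function.update_self]
          exact addEdge_le (hle i) (hlink e he)
        · simpa [hi] using hle i)
      (fun i => by
        by_cases hi : i = c
        · subst hi
          rw [Function.update_self]
          exact (hforest i).addEdge hw
        · simpa [hi] using hforest i)
      (fun i j hij => by
        by_cases hi : i = c
        · subst hi
          rw [Function.update_self, Function.update_of_ne hij.symm]
          exact hdisjK j hij.symm
        · rw [Function.update_of_ne hi]
          by_cases hj : j = c
          · subst hj
            rw [Function.update_self]
            exact (hdisjK i hi).symm
          · rw [Function.update_of_ne hj]
            exact hdisj i j hij)
      (fun i f hf => by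
        have hfR := hR i f (Finset.mem_of_mem_erase hf)
        by_cases hi : i = c
        · subst hi
          rw [Function.update_self, hKe]
          rintro (hfe | hh)
          · exact Finset.ne_of_mem_erase hf hfe
          · exact hfR hh
        · rwa [Function.update_of_ne hi]) rfl
    refine ⟨F', C', h1, h2, h3, h4, h5, fun i => ?_⟩
    rw [h6]
    by_cases hi : i = c
    · subst hi
      rw [Function.update_self]
      exact numComponents_addEdge hw
    · rw [Function.update_of_ne hi]

end Packing


/-! ### Necessity -/

section Necessity

variable {α β γ : Type*}

/-- Enlarge `S` by one label at a time along an edge that leaves it. This edge then has both labels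
in `S` and drops out of the count, so each new label is paid for by an edge of its own. -/
theorem ncard_image_le_add_of_reaches {H : Graph α β} (hV : H.vertexSet.Finite)
    (hE : H.edgeSet.Finite) (f : α → γ) (S : Set γ)
    (hS : ∀ x ∈ H.vertexSet, ∃ y ∈ reachableSet H x, f y ∈ S) (hSV : S ⊆ f '' H.vertexSet) :
    (f '' H.vertexSet).ncard ≤
      S.ncard + {e | ∃ x y, H.IsLink e x y ∧ f x ≠ f y ∧ f x ∉ S}.ncard := by
  have hL : (f '' H.vertexSet).Finite := hV.image f
  induction hn : (f '' H.vertexSet \ S).ncard using Nat.strong_induction_on generalizing S with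
  | _ n ih =>
    by_cases hall : f '' H.vertexSet ⊆ S
    · exact (Set.ncard_le_ncard hall (hL.subset hSV)).trans (Nat.le_add_right _ _)
    obtain ⟨_, ⟨x, hx, rfl⟩, hxS⟩ := Set.not_subset.1 hall
    obtain ⟨y, hxy, hyS⟩ := hS x hx
    obtain ⟨e, z, z', he, hz, hz'⟩ : ∃ e z z', H.IsLink e z z' ∧ f z ∉ S ∧ f z' ∈ S := by
      by_contra hcon
      push Not at hcon
      have : f y ∉ S := by
        clear hyS
        induction hxy with
        | refl => exact hxS
        | tail _ hbc ih =>
          obtain ⟨e, he⟩ := hbc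
          exact hcon e _ _ he ih
      exact this hyS
    have hzV : f z ∈ f '' H.vertexSet := ⟨z, he.left_mem, rfl⟩
    have hlt : (f '' H.vertexSet \ insert (f z) S).ncard < n := by
      rw [← hn]
      refine Set.ncard_lt_ncard ?_ (hL.subset Set.sdiff_subset)
      refine (Set.ssubset_iff_of_subset ?_).2 ⟨f z, ⟨hzV, hz⟩, fun h => h.2 (.inl rfl)⟩
      exact Set.sdiff_subset_sdiff_right (Set.subset_insert _ _)
    have h1 := ih _ hlt (insert (f z) S)
      (fun x hx => (hS x hx).imp fun y hy => ⟨hy.1, .inr hy.2⟩) (Set.insert_subset hzV hSV) rfl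
    have h2 := Set.ncard_insert_le (f z) S
    have h3 : {e | ∃ x y, H.IsLink e x y ∧ f x ≠ f y ∧ f x ∉ insert (f z) S}.ncard <
        {e | ∃ x y, H.IsLink e x y ∧ f x ≠ f y ∧ f x ∉ S}.ncard := by
      refine Set.ncard_lt_ncard ?_ (hE.subset fun e ⟨x, y, h, _⟩ => h.edge_mem)
      refine (Set.ssubset_iff_of_subset ?_).2 ⟨e, ⟨z, z', he, fun h => hz (h ▸ hz'), hz⟩, ?_⟩
      · rintro e ⟨x, y, h, hne, hn⟩
        exact ⟨x, y, h, hne, fun hh => hn (.inr hh)⟩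
      · rintro ⟨x, y, h, hne, hn⟩
        rcases he.left_eq_or_eq h with rfl | rfl
        · exact hn (.inl rfl)
        · rcases he.right_eq_or_eq h with rfl | rfl
          · exact hn (.inr hz')
          · exact hz hz'
    omega

/-- If the vertices of a graph are labelled, the number of labels is at most the number of
components plus the number of the edges whose ends have different labels. -/
theorem ncard_image_le {H : Graph α β} (hV : H.vertexSet.Finite) (hE : H.edgeSet.Finite)
    (f : α → γ) :
    (f '' H.vertexSet).ncard ≤
      numComponents H + {e | ∃ x y, H.IsLink e x y ∧ f x ≠ f y}.ncard := by
  have hfin : (components H).Finite := by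
    refine (hV.image (reachableSet H)).subset ?_
    rintro _ ⟨x, hx, rfl⟩
    exact ⟨x, hx, rfl⟩
  have hne : ∀ C : components H, (C : Set α).Nonempty := by
    rintro ⟨_, x, hx, rfl⟩
    exact ⟨x, .refl⟩
  choose g hg using hne
  have h1 := ncard_image_le_add_of_reaches hV hE f (Set.range fun C => f (g C))
    (fun x hx => ⟨_, hg ⟨_, x, hx, rfl⟩, ⟨_, rfl⟩⟩) (by
      rintro _ ⟨⟨_, x, hx, rfl⟩, rfl⟩
      exact ⟨_, reachableSet_subset hx (hg ⟨_, x, hx, rfl⟩), rfl⟩)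
  have h2 : (Set.range fun C : components H => f (g C)).ncard ≤ numComponents H := by
    have := hfin.to_subtype
    rw [← Set.image_univ]
    refine (Set.ncard_image_le Set.finite_univ).trans ?_
    rw [Set.ncard_univ]
    exact le_rfl
  have h3 : {e | ∃ x y, H.IsLink e x y ∧ f x ≠ f y ∧
      f x ∉ Set.range fun C : components H => f (g C)}.ncard ≤
      {e | ∃ x y, H.IsLink e x y ∧ f x ≠ f y}.ncard := by
    refine Set.ncard_le_ncard ?_ (hE.subset fun e ⟨x, y, h, _⟩ => h.edge_mem)
    rintro e ⟨x, y, h, hne, -⟩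
    exact ⟨x, y, h, hne⟩
  omega

theorem numComponents_le_ncard {H : Graph α β} (hV : H.vertexSet.Finite) :
    numComponents H ≤ H.vertexSet.ncard := by
  have : components H = reachableSet H '' H.vertexSet := by
    ext C
    exact ⟨fun ⟨x, hx, h⟩ => ⟨x, hx, h.symm⟩, fun ⟨x, hx, h⟩ => ⟨x, hx, h.symm⟩⟩
  rw [numComponents, this]
  exact Set.ncard_image_le hV

variable {G : Graph α β} {h k : ℕ} {F : Fin k → Graph α β}

theorem IsRegularForestPacking.sum_ncard_vertexSet (hF : IsRegularForestPacking G h k F)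
    (hV : G.vertexSet.Finite) : ∑ i, (F i).vertexSet.ncard = h * G.vertexSet.ncard := by
  classical
  have h1 : ∀ i, (F i).vertexSet.ncard =
      ∑ v ∈ hV.toFinset, if v ∈ (F i).vertexSet then 1 else 0 := by
    intro i
    rw [← Finset.card_filter, ← Set.ncard_coe_finset]
    congr 1
    ext v
    simpa using fun hv => (hF.le i).vertexSet_mono hv
  simp only [h1]
  rw [Finset.sum_comm]
  have h2 : ∀ v ∈ hV.toFinset, ∑ i, (if v ∈ (F i).vertexSet then 1 else 0) = h := by
    intro v hv
    rw [← Finset.card_filter, ← Set.ncard_coe_finset, ← hF.regular v (hV.mem_toFinset.1 hv)]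
    congr 1
    ext i
    simp
  rw [Finset.sum_congr rfl h2, Finset.sum_const, Set.ncard_eq_toFinset_card _ hV, smul_eq_mul,
    mul_comm]

/-- Count the pairs of a part and a forest meeting it. Any vertex of a part provides `h` forests;
from the other side, apply `ncard_image_le` with parts as labels. -/
theorem IsRegularForestPacking.mul_card_parts_le (hF : IsRegularForestPacking G h k F)
    (hV : G.vertexSet.Finite) (hE : G.edgeSet.Finite) (P : Finpartition G.vertexSet) :
    h * P.parts.card ≤
      ∑ i, min (numComponents (F i)) P.parts.card + crossingNumber G P := by
  classical
  have hpart : ∀ X ∈ P.parts, X ⊆ G.vertexSet := fun X hX => P.le hX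
  have hne : ∀ X ∈ P.parts, X.Nonempty := fun X hX => Set.nonempty_iff_ne_empty.2 (P.ne_bot hX)
  have huniq : ∀ X ∈ P.parts, ∀ Y ∈ P.parts, ∀ x, x ∈ X → x ∈ Y → X = Y := by
    intro X hX Y hY x hxX hxY
    by_contra hXY
    exact Set.disjoint_left.1 (P.disjoint hX hY hXY) hxX hxY
  have hcov : ∀ x ∈ G.vertexSet, ∃ X ∈ P.parts, x ∈ X := by
    intro x hx
    have h1 := P.sup_parts
    rw [Finset.sup_set_eq_biUnion] at h1
    rw [← h1] at hx
    simpa using hx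
  obtain ⟨f, hf⟩ : ∃ f : α → Set α, ∀ X ∈ P.parts, ∀ x ∈ X, f x = X := by
    refine ⟨fun x => if hx : ∃ X ∈ P.parts, x ∈ X then hx.choose else ∅, fun X hX x hx => ?_⟩
    have hex : ∃ X ∈ P.parts, x ∈ X := ⟨X, hX, hx⟩
    simp only [dif_pos hex]
    exact huniq _ hex.choose_spec.1 X hX x hex.choose_spec.2 hx
  have hEF : ∀ i, (F i).edgeSet.Finite := fun i => hE.subset (hF.le i).edgeSet_mono
  set D : Fin k → Set β := fun i => {e ∈ (F i).edgeSet | ∃ X ∈ P.parts, Enters G e X} with hD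
  have hDfin : ∀ i, (D i).Finite := fun i => (hEF i).subset fun e he => he.1
  have hDsum : ∑ i, (D i).ncard ≤ crossingNumber G P := by
    have h1 : ∑ i, (D i).ncard = (Finset.univ.biUnion fun i => (hDfin i).toFinset).card := by
      rw [Finset.card_biUnion]
      · exact Finset.sum_congr rfl fun i _ => Set.ncard_eq_toFinset_card _ _
      · intro i _ j _ hij
        refine Finset.disjoint_left.2 fun e he he' => ?_
        rw [Set.Finite.mem_toFinset] at he he'
        exact Set.disjoint_left.1 (hF.edgeDisjoint i j hij) he.1 he'.1
    rw [h1, ← Set.ncard_coe_finset]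
    refine Set.ncard_le_ncard ?_ (hE.subset fun e he => he.1)
    intro e he
    obtain ⟨i, -, hi⟩ := Finset.mem_biUnion.1 he
    rw [Set.Finite.mem_toFinset] at hi
    exact ⟨(hF.le i).edgeSet_mono hi.1, hi.2⟩
  have hm : ∀ i, {X ∈ P.parts | ∃ x ∈ (F i).vertexSet, x ∈ X}.card ≤
      min (numComponents (F i)) P.parts.card + (D i).ncard := by
    intro i
    have h1 := ncard_image_le (hV.subset (hF.le i).vertexSet_mono) (hEF i) f
    have h2 : f '' (F i).vertexSet = ↑{X ∈ P.parts | ∃ x ∈ (F i).vertexSet, x ∈ X} := by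
      ext X
      simp only [Set.mem_image, Finset.coe_filter, Set.mem_ofPred_eq]
      constructor
      · rintro ⟨x, hx, rfl⟩
        obtain ⟨X, hX, hxX⟩ := hcov x ((hF.le i).vertexSet_mono hx)
        rw [hf X hX x hxX]
        exact ⟨hX, x, hx, hxX⟩
      · rintro ⟨hX, x, hx, hxX⟩
        exact ⟨x, hx, hf X hX x hxX⟩
    rw [h2, Set.ncard_coe_finset] at h1
    have h3 : {e | ∃ x y, (F i).IsLink e x y ∧ f x ≠ f y}.ncard ≤ (D i).ncard := by
      refine Set.ncard_le_ncard ?_ (hDfin i)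
      rintro e ⟨x, y, he, hxy⟩
      obtain ⟨X, hX, hxX⟩ := hcov x ((hF.le i).vertexSet_mono he.left_mem)
      refine ⟨he.edge_mem, X, hX, x, y, he.mono (hF.le i), hxX, fun hyX => hxy ?_⟩
      rw [hf X hX x hxX, hf X hX y hyX]
    have h4 := Finset.card_filter_le P.parts (fun X => ∃ x ∈ (F i).vertexSet, x ∈ X)
    omega
  have hlow : h * P.parts.card ≤ ∑ i, {X ∈ P.parts | ∃ x ∈ (F i).vertexSet, x ∈ X}.card := by
    simp only [Finset.card_filter]
    rw [Finset.sum_comm, mul_comm, ← smul_eq_mul]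
    refine Finset.card_nsmul_le_sum _ _ _ fun X hX => ?_
    obtain ⟨v, hv⟩ := hne X hX
    rw [← Finset.card_filter, ← hF.regular v (hpart X hX hv), ← Set.ncard_coe_finset]
    refine Set.ncard_le_ncard ?_ (Finset.finite_toSet _)
    intro i hi
    simpa using ⟨v, hi, hv⟩
  have := Finset.sum_le_sum fun i (_ : i ∈ Finset.univ) => hm i
  rw [Finset.sum_add_distrib] at this
  omega

end Necessity


/-! ### Sufficiency -/

section Sufficiency

variable {α β : Type*}

theorem crossingNumber_indiscrete (G : Graph α β) (hne : G.vertexSet ≠ ⊥) :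
    crossingNumber G (Finpartition.indiscrete hne) = 0 := by
  have : {e ∈ G.edgeSet | ∃ X ∈ (Finpartition.indiscrete hne).parts, Enters G e X} = ∅ := by
    refine Set.eq_empty_of_forall_notMem ?_
    rintro e ⟨-, X, hX, x, y, he, -, hy⟩
    obtain rfl : X = G.vertexSet := by simpa using hX
    exact hy he.right_mem
  rw [crossingNumber, this, Set.ncard_empty]

/-- A partition of the vertices together with a further element `none` yields a partition of the
vertices. -/
theorem exists_finpartition_of_isPartition [DecidableEq α] {G : Graph α β}
    (hV : G.vertexSet.Finite) (hE : G.edgeSet.Finite) {s t : β → α}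
    (hst : ∀ e ∈ G.edgeSet, G.IsLink e (s e) (t e)) {P : Finset (Finset (Option α))}
    (hP : IsPartition (Finset.insertNone hV.toFinset) P) :
    ∃ Q : Finpartition G.vertexSet, (Q.parts.card + 1 = P.card ∨ Q.parts.card = P.card) ∧
      crossingNumber G Q ≤
        crossCount hE.toFinset (fun e => some (s e)) (fun e => some (t e)) P := by
  classical
  set g : Finset (Option α) → Set α := fun X => {x | some x ∈ X} with hg
  set R := {X ∈ P | ∃ x, some x ∈ X} with hR
  have hRP : R ⊆ P := Finset.filter_subset _ _
  have hinj : Set.InjOn g R := by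
    intro X hX Y hY hXY
    obtain ⟨x, hx⟩ := (Finset.mem_filter.1 hX).2
    have hx' : x ∈ g Y := hXY ▸ hx
    exact hP.eq_of_mem X (hRP hX) Y (hRP hY) (some x) hx hx'
  have hmemU : ∀ x : α, some x ∈ Finset.insertNone hV.toFinset ↔ x ∈ G.vertexSet := by simp
  let Q : Finpartition G.vertexSet :=
    { parts := R.image g
      supIndep := by
        rw [Finset.supIndep_iff_pairwiseDisjoint]
        intro A hA B hB hAB
        obtain ⟨X, hX, rfl⟩ := Finset.mem_image.1 hA
        obtain ⟨Y, hY, rfl⟩ := Finset.mem_image.1 hB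
        refine Set.disjoint_left.2 fun x hx hx' => hAB ?_
        rw [hP.eq_of_mem X (hRP hX) Y (hRP hY) (some x) hx hx']
      sup_parts := by
        rw [Finset.sup_set_eq_biUnion]
        ext x
        rw [← hmemU, ← hP.covers]
        simp only [Set.mem_iUnion, id, exists_prop]
        constructor
        · rintro ⟨_, hA, hx⟩
          obtain ⟨X, hX, rfl⟩ := Finset.mem_image.1 hA
          exact ⟨X, hRP hX, hx⟩
        · rintro ⟨X, hX, hx⟩
          exact ⟨g X, Finset.mem_image_of_mem _ (Finset.mem_filter.2 ⟨hX, x, hx⟩), hx⟩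
      bot_notMem := by
        intro hmem
        obtain ⟨X, hX, hXe⟩ := Finset.mem_image.1 hmem
        obtain ⟨x, hx⟩ := (Finset.mem_filter.1 hX).2
        have : x ∈ g X := hx
        rw [hXe] at this
        exact this }
  refine ⟨Q, ?_, ?_⟩
  · have h1 : Q.parts.card = R.card := Finset.card_image_of_injOn hinj
    obtain ⟨Z, hZ, hzZ⟩ := (hP.covers none).2 (by simp)
    have h2 : P.erase Z ⊆ R := by
      intro X hX
      obtain ⟨hXZ, hXP⟩ := Finset.mem_erase.1 hX
      obtain ⟨w, hw⟩ := hP.nonempty X hXP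
      cases w with
      | none => exact absurd (hP.eq_of_mem X hXP Z hZ none hw hzZ) hXZ
      | some x => exact Finset.mem_filter.2 ⟨hXP, x, hw⟩
    have h3 := Finset.card_le_card h2
    have h4 := Finset.card_le_card hRP
    have h5 := Finset.card_erase_add_one hZ
    omega
  · rw [crossingNumber, crossCount, ← Set.ncard_coe_finset]
    refine Set.ncard_le_ncard ?_ (Finset.finite_toSet _)
    rintro e ⟨he, A, hA, x, y, hxy, hx, hy⟩
    obtain ⟨X, hX, rfl⟩ := Finset.mem_image.1 hA
    have hx : some x ∈ X := hx
    have hy : some y ∉ X := hy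
    refine Finset.mem_coe.2 (Finset.mem_filter.2 ⟨hE.mem_toFinset.2 he, X, hRP hX, fun hiff => ?_⟩)
    rcases (hst e he).eq_and_eq_or_eq_and_eq hxy with ⟨h1, h2⟩ | ⟨h1, h2⟩
    · rw [h1, h2] at hiff
      exact hy (hiff.1 hx)
    · rw [h1, h2] at hiff
      exact hy (hiff.2 hx)

variable {h k : ℕ} {l : Fin k → ℕ}

/-- The sum of minima drops by the number of `i` with `l i > q`. If this is at most `h`, subtract;
otherwise these terms alone sum to at least `h * q`. This covers the case in which the class of `z`
contains other vertices. -/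
theorem sum_min_mul_le {q c : ℕ} (hq : h * (q + 1) ≤ ∑ i, min (l i) (q + 1) + c) :
    h * q ≤ ∑ i, min (l i) q + c := by
  classical
  have h1 : ∑ i, min (l i) (q + 1) = ∑ i, min (l i) q + ({i | q < l i} : Finset (Fin k)).card := by
    rw [Finset.card_filter, ← Finset.sum_add_distrib]
    refine Finset.sum_congr rfl fun i _ => ?_
    split_ifs <;> omega
  have h2 : ({i | q < l i} : Finset (Fin k)).card * q ≤ ∑ i, min (l i) q := by
    rw [← smul_eq_mul]
    refine (Finset.card_nsmul_le_sum _ (fun i => min (l i) q) _ fun i hi => ?_).trans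
      (Finset.sum_le_sum_of_subset (Finset.subset_univ _))
    have := (Finset.mem_filter.1 hi).2
    omega
  rcases le_total ({i | q < l i} : Finset (Fin k)).card h with h3 | h3
  · rw [mul_add, mul_one] at hq
    omega
  · have := Nat.mul_le_mul_right q h3
    omega

/-- The colours of the root vertex `none` and of the other vertices before roots are placed. -/
def initialColours (α : Type*) (k : ℕ) : Option α → Finset (Fin k)
  | none => Finset.univ
  | some _ => ∅

/-- All `q` classes other than that of `none` are free of every colour, and `q - l i + min (l i) q =
q`. With `k = h + d`, the claim becomes the partition condition with `q` parts. -/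
theorem rootCondition_initialColours [DecidableEq α] {G : Graph α β}
    (hV : G.vertexSet.Finite) (hE : G.edgeSet.Finite) {s t : β → α}
    (hst : ∀ e ∈ G.edgeSet, G.IsLink e (s e) (t e)) {d : ℕ} (hd : k = h + d)
    (hcond : ∀ P : Finpartition G.vertexSet,
      h * P.parts.card ≤ (∑ i, min (l i) P.parts.card) + crossingNumber G P) :
    RootCondition (Finset.insertNone hV.toFinset) hE.toFinset (fun e => some (s e))
      (fun e => some (t e)) d (initialColours α k) l := by
  intro P hP
  obtain ⟨Z, hZ, hzZ⟩ := (hP.covers none).2 (by simp)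
  have hfree : ∀ i, freeCount (initialColours α k) i P = P.card - 1 := by
    intro i
    rw [freeCount, ← Finset.card_erase_of_mem hZ]
    congr 1
    ext X
    rw [Finset.mem_filter, Finset.mem_erase, and_comm]
    refine and_congr_left fun hX => ⟨?_, fun hXZ => ?_⟩
    · rintro hf rfl
      exact hf none hzZ (by simp [initialColours])
    · intro v hv
      cases v with
      | none => exact absurd (hP.eq_of_mem X hX Z hZ none hv hzZ) hXZ
      | some x => simp [initialColours]
  obtain ⟨q, hq⟩ : ∃ q, P.card = q + 1 :=
    ⟨P.card - 1, by have := Finset.card_pos.2 ⟨Z, hZ⟩; omega⟩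
  obtain ⟨Q, hQ, hcross⟩ := exists_finpartition_of_isPartition hV hE hst hP
  have h1 := hcond Q
  have h2 : h * q ≤ ∑ i, min (l i) q + crossingNumber G Q := by
    rcases hQ with hQ | hQ
    · rwa [show Q.parts.card = q by omega] at h1
    · rw [hQ, hq] at h1
      exact sum_min_mul_le h1
  have h3 : ∑ i, (q - l i) + ∑ i, min (l i) q = (h + d) * q := by
    rw [← Finset.sum_add_distrib, ← hd]
    have : ∀ i, q - l i + min (l i) q = q := fun i => by omega
    simp [this]
  simp only [hfree, hq, Nat.add_sub_cancel]
  rw [mul_add, mul_one]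
  rw [add_mul] at h3
  omega

/-- Under the conditions of the theorem there are root sets of the prescribed sizes and an
orientation of the graph that satisfy the cover condition. -/
theorem exists_roots_orientation [DecidableEq α] {G : Graph α β} (hV : G.vertexSet.Finite)
    (hE : G.edgeSet.Finite) (hne : G.vertexSet.Nonempty)
    (hlV : ∀ i, l i ≤ G.vertexSet.ncard) (hsum : ∑ i, l i ≤ h * G.vertexSet.ncard)
    (hcond : ∀ P : Finpartition G.vertexSet,
      h * P.parts.card ≤ (∑ i, min (l i) P.parts.card) + crossingNumber G P) :
    ∃ (C : α → Finset (Fin k)) (a b : β → α), (∀ e ∈ G.edgeSet, G.IsLink e (a e) (b e)) ∧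
      (∀ v ∈ G.vertexSet, (C v).card ≤ h) ∧ (∀ i, colourCount hV.toFinset C i = l i) ∧
      CoverCondition hV.toFinset hE.toFinset a b h C := by
  classical
  have : Nonempty α := ⟨hne.some⟩
  -- The partition into one class gives this; it makes `d = k - h` a natural number.
  have hkh : h ≤ k := by
    have hne' : G.vertexSet ≠ ⊥ := hne.ne_empty
    have h1 := hcond (Finpartition.indiscrete hne')
    rw [crossingNumber_indiscrete] at h1
    simp only [Finpartition.indiscrete_parts, Finset.card_singleton, mul_one, add_zero] at h1
    refine h1.trans ((Finset.sum_le_card_nsmul _ _ 1 fun i _ => min_le_right _ _).trans ?_)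
    simp
  obtain ⟨d, hd⟩ := Nat.exists_eq_add_of_le hkh
  have hends : ∀ e, ∃ x y, e ∈ G.edgeSet → G.IsLink e x y := by
    intro e
    by_cases he : e ∈ G.edgeSet
    · obtain ⟨x, y, hxy⟩ := G.exists_isLink_of_mem_edgeSet he
      exact ⟨x, y, fun _ => hxy⟩
    · exact ⟨hne.some, hne.some, fun h => absurd h he⟩
  choose s t hst using hends
  have hcardk : Fintype.card (Fin k) = h + d := by rw [Fintype.card_fin, hd]
  have hz : (none : Option α) ∈ Finset.insertNone hV.toFinset := by simp
  have hVU : (Finset.insertNone hV.toFinset).erase none =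
      hV.toFinset.map Function.Embedding.some := by
    ext x
    cases x <;> simp
  obtain ⟨C₁, hC₁, hC₁z, hC₁h, hC₁l⟩ :=
    (rootCondition_initialColours hV hE hst hd hcond).place_all hcardk hz rfl (by
      intro v hv
      cases v with
      | none => simp at hv
      | some x => simp [initialColours])
  have hendsU : ∀ e ∈ hE.toFinset, some (s e) ∈ Finset.insertNone hV.toFinset ∧
      some (t e) ∈ Finset.insertNone hV.toFinset := by
    intro e he
    have := hst e (hE.mem_toFinset.1 he)
    simp [this.left_mem, this.right_mem]
  obtain ⟨a, b, hab, hcov⟩ := exists_orientation ((Finset.insertNone hV.toFinset).erase none)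
    hE.toFinset (fun e => some (s e)) (fun e => some (t e)) _
    (intersectingSupermodular_sub_card C₁ h)
    (fun P hP hPU => hC₁.sum_le hcardk hz hC₁z hendsU hP hPU)
  obtain ⟨C₂, hC₂h, hC₂l, hC₂⟩ := exists_colourCount_eq (l := l) (inDegree hE.toFinset a b) hC₁h
    (fun i => (hC₁l i).trans (by
      have : colourCount ((Finset.insertNone hV.toFinset).erase none)
          (initialColours α k) i = 0 := by
        rw [hVU, colourCount, Finset.card_eq_zero, Finset.filter_eq_empty_iff]
        intro v hv
        obtain ⟨x, -, rfl⟩ := Finset.mem_map.1 hv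
        simp [initialColours]
      omega))
    (fun X hX hXne => by
      have := hcov X hX hXne
      unfold inDegree
      omega)
    (fun i => by
      rw [hVU, Finset.card_map, ← Set.ncard_eq_toFinset_card _ hV]
      exact hlV i)
    (by rw [hVU, Finset.card_map, ← Set.ncard_eq_toFinset_card _ hV]; exact hsum)
  have hab' : ∀ e, ∃ x y, a e = some x ∧ b e = some y ∧
      (x = s e ∧ y = t e ∨ x = t e ∧ y = s e) := by
    intro e
    rcases hab e with ⟨h1, h2⟩ | ⟨h1, h2⟩
    · exact ⟨s e, t e, h1, h2, .inl ⟨rfl, rfl⟩⟩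
    · exact ⟨t e, s e, h1, h2, .inr ⟨rfl, rfl⟩⟩
  choose a' b' ha hb hab' using hab'
  refine ⟨fun v => C₂ (some v), a', b', fun e he => ?_, fun v hv => ?_, fun i => ?_,
    fun X hX hXne => ?_⟩
  · rcases hab' e with ⟨h1, h2⟩ | ⟨h1, h2⟩
    · rw [h1, h2]
      exact hst e he
    · rw [h1, h2]
      exact (hst e he).symm
  · exact hC₂h _ (by simp [hv])
  · rw [← hC₂l i, hVU, colourCount, colourCount, Finset.filter_map, Finset.card_map]
    rfl
  · have h1 := hC₂ (X.map Function.Embedding.some) (hVU ▸ Finset.map_subset_map.2 hX) (by simpa)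
    have h2 : inDegree hE.toFinset a b (X.map Function.Embedding.some) =
        inDegree hE.toFinset a' b' X := by
      unfold inDegree
      congr 1
      refine Finset.filter_congr fun e _ => ?_
      rw [ha, hb]
      simp
    have h3 : (X.map Function.Embedding.some).biUnion C₂ = X.biUnion fun v => C₂ (some v) := by
      ext c
      simp
    rw [h2, h3] at h1
    exact h1

end Sufficiency

end ForestPacking

theorem mainTheorem4 {α β : Type*} (G : Graph α β)
    (hV : G.vertexSet.Finite) (hE : G.edgeSet.Finite)
    (h k : ℕ) (hh : 0 < h) (hk : 0 < k) (l : Fin k → ℕ) (hl : ∀ i, 0 < l i) :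
    (∃ F : Fin k → Graph α β, ForestPacking.IsRegularForestPacking G h k F ∧
        ∀ i, ForestPacking.numComponents (F i) = l i) ↔
      (∀ i, l i ≤ G.vertexSet.ncard) ∧
      (∑ i, l i ≤ h * G.vertexSet.ncard) ∧
      (∀ P : Finpartition G.vertexSet,
        h * P.parts.card ≤
          (∑ i, min (l i) P.parts.card) + ForestPacking.crossingNumber G P) := by
  classical
  constructor
  · rintro ⟨F, hF, hFl⟩
    obtain rfl : (fun i => ForestPacking.numComponents (F i)) = l := funext hFl
    have hfin : ∀ i, (F i).vertexSet.Finite := fun i => hV.subset (hF.le i).vertexSet_mono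
    refine ⟨fun i => ?_, ?_, fun P => hF.mul_card_parts_le hV hE P⟩
    · exact (ForestPacking.numComponents_le_ncard (hfin i)).trans
        (Set.ncard_le_ncard (hF.le i).vertexSet_mono hV)
    · rw [← hF.sum_ncard_vertexSet hV]
      exact Finset.sum_le_sum fun i _ => ForestPacking.numComponents_le_ncard (hfin i)
  · rintro ⟨h1, h2, h3⟩
    have hne : G.vertexSet.Nonempty := by
      refine (Set.ncard_pos hV).1 ((hl ⟨0, hk⟩).trans_le (h1 _))
    obtain ⟨C, a, b, hlink, hCh, hCl, hcov⟩ :=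
      ForestPacking.exists_roots_orientation hV hE hne h1 h2 h3
    -- The colours outside the vertex set are arbitrary and must be removed, since the initial
    -- edgeless forests are the colour classes and have to be subgraphs of `G`.
    set C' : α → Finset (Fin k) := fun v => if v ∈ G.vertexSet then C v else ∅ with hC'
    have hCC : ∀ v ∈ G.vertexSet, C' v = C v := fun v hv => if_pos hv
    have hcov' : ForestPacking.CoverCondition hV.toFinset hE.toFinset a b h C' := by
      intro X hX hXne
      have hXC : X.biUnion C' = X.biUnion C :=
        Finset.biUnion_congr rfl fun v hv => hCC v (hV.mem_toFinset.1 (hX hv))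
      rw [hXC]
      exact hcov X hX hXne
    obtain ⟨F, D, hD, hle, hforest, hdisj, hDh, hnum⟩ := hcov'.exists_packing (G := G)
      (V := hV.toFinset) (by simp) (fun e he => hlink e (hE.mem_toFinset.1 he))
      (fun v hv => by
        have hv := hV.mem_toFinset.1 hv
        rw [hCC v hv]
        exact hCh v hv)
      (fun i => Graph.noEdge {v | i ∈ C' v} β) (fun v i => Iff.rfl)
      (fun i => by
        rw [Graph.noEdge_le_iff]
        intro v hv
        by_contra hvV
        have hv : i ∈ C' v := hv
        simp [hC', hvV] at hv)
      (fun i => ForestPacking.isForest_noEdge _) (fun i j _ => by simp) (fun i e _ => by simp)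
    refine ⟨F, ⟨hle, hforest, hdisj, fun v hv => ?_⟩, fun i => ?_⟩
    · rw [← hDh v (hV.mem_toFinset.2 hv), ← Set.ncard_coe_finset]
      congr 1
      ext i
      exact (hD v i).symm
    · rw [hnum, ForestPacking.numComponents_noEdge, ← hCl i, ForestPacking.colourCount,
        ← Set.ncard_coe_finset]
      congr 1
      ext v
      by_cases hv : v ∈ G.vertexSet <;> simp [hC', hv]
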